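/- Let $n,m$ be natural numbers. Let $W\in C^1(\mathbb{R}^m;\mathbb{R})$ be nonnegative and suppose that there are $Q\in\mathbb{R}^m$, a real number $p\ge 2$ and a constant $C_2>0$ such that $$-(v-Q)\cdot \nabla W(v)\le C_2\,W(v)^{\frac{p-1}{p}}\qquad\text{for all } v\in\mathbb{R}^m,$$ where $\cdot$ is the Euclidean inner product. Let $u\in C^2(\mathbb{R}^n;\mathbb{R}^m)$ be a bounded solution of $\Delta u=\nabla W(u)$ on $\mathbb{R}^n$. Let $B_r$ denote the open ball of radius $r$ centred at the origin of $\mathbb{R}^n$. (I) If $n\ge 4$ and $$\int_{B_r}W(u(x))\,dx=o(r^{q})\quad\text{as } r\to\infty,\qquad q=\frac{p}{p-1}\Big(n-2-\frac np\Big)=n-2-\frac{2}{p-1},$$ then $u$ is constant. (II) If $n=4$, $p=2$ and $\int_{\mathbb{R}^n}W(u(x))\,dx<\infty$, then $u$ is constant. -/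

import Mathlib

open MeasureTheory Filter Asymptotics Topology
open scoped InnerProductSpace Gradient Laplacian

/-! Write `e = |∇u|²/2 + W(u)` and `E(R) = ∫_{B_R} e`. Two identities drive the proof. Testing the
equation with a cutoff times `u - Q` (Caccioppoli) bounds `∫_{B_R} |∇u|²` by `∫ k(u)`, where `k = C₂
W^((p-1)/p)`, plus a cutoff term of size `R^(n-2)`; hence `E(R) = O(R^(n-2))`. The Pohozaev identity
with weight `(1+|x|²)^(-(n-2)/2)` bounds both the weighted energy and the weighted radial derivative
on `B_R` by a multiple of `R^(2-n) E(2R)` (`setIntegral_weighted_energy_le`).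

These combine in a bootstrap. Since `R^(2-n) E(2R)` is bounded, the weighted radial energy is finite
on the whole space, so its part in `B_{2R} \ B_R` tends to `0`. The cutoff term in Caccioppoli
involves only the radial derivative on that annulus, so it improves to `o(R^(n-2))`. Then `E(R) =
o(R^(n-2))`, and the Pohozaev bound forces the weighted energy to vanish
(`exists_eq_const_of_isLittleO`).

What remains is `∫_{B_R} W(u)^((p-1)/p) = o(R^(n-2))`. It follows from a Young-type inequality whose
parameter is proportional to `R²`; the exponent `q` is exactly what this scaling requires. In the
borderline case `n = 4`, `p = 2` one has `q = 0`, and the small tail of the convergent integral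
replaces the little-o hypothesis. -/

/-- The squared Hilbert–Schmidt norm of the differential of `u` at `x`. -/
noncomputable def gradSq {n : ℕ} {F : Type*} [NormedAddCommGroup F] [InnerProductSpace ℝ F]
    (u : EuclideanSpace ℝ (Fin n) → F) (x : EuclideanSpace ℝ (Fin n)) : ℝ :=
  ∑ i, ‖fderiv ℝ u x (EuclideanSpace.basisFun (Fin n) ℝ i)‖ ^ 2

/-- The energy density `|∇u|² / 2 + W(u)`. -/
noncomputable def energyDensity {n : ℕ} {F : Type*} [NormedAddCommGroup F]
    [InnerProductSpace ℝ F] (W : F → ℝ)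
    (u : EuclideanSpace ℝ (Fin n) → F) (x : EuclideanSpace ℝ (Fin n)) : ℝ :=
  gradSq u x / 2 + W (u x)

/-! ### Integral identities from the divergence theorem -/

section Identities

variable {n : ℕ} {F : Type*} [NormedAddCommGroup F] [InnerProductSpace ℝ F]

theorem gradSq_nonneg (u : EuclideanSpace ℝ (Fin n) → F) (x : EuclideanSpace ℝ (Fin n)) :
    0 ≤ gradSq u x :=
  Finset.sum_nonneg fun _ _ => sq_nonneg _

theorem continuous_fderiv_basisFun {u : EuclideanSpace ℝ (Fin n) → F} (hu : ContDiff ℝ 1 u)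
    (v : EuclideanSpace ℝ (Fin n)) : Continuous fun x => fderiv ℝ u x v :=
  (hu.continuous_fderiv one_ne_zero).clm_apply continuous_const

theorem continuous_gradSq {u : EuclideanSpace ℝ (Fin n) → F} (hu : ContDiff ℝ 1 u) :
    Continuous (gradSq u) :=
  continuous_finsetSum _ fun _ _ => ((continuous_fderiv_basisFun hu _).norm.pow 2)

theorem sum_inner_basisFun_smul (x : EuclideanSpace ℝ (Fin n)) :
    ∑ i, x i • EuclideanSpace.basisFun (Fin n) ℝ i = x := by
  simpa using (EuclideanSpace.basisFun (Fin n) ℝ).sum_repr x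

theorem sum_smul_apply_basisFun {G : Type*} [NormedAddCommGroup G] [NormedSpace ℝ G]
    (L : EuclideanSpace ℝ (Fin n) →L[ℝ] G) (x : EuclideanSpace ℝ (Fin n)) :
    ∑ i, x i • L (EuclideanSpace.basisFun (Fin n) ℝ i) = L x := by
  conv_rhs => rw [← sum_inner_basisFun_smul x]
  rw [map_sum]
  exact Finset.sum_congr rfl fun i _ => (L.map_smul _ _).symm

theorem norm_fderiv_apply_sq_le (u : EuclideanSpace ℝ (Fin n) → F)
    (x v : EuclideanSpace ℝ (Fin n)) : ‖fderiv ℝ u x v‖ ^ 2 ≤ ‖v‖ ^ 2 * gradSq u x := by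
  have h1 : ‖fderiv ℝ u x v‖ ≤
      ∑ i, |v i| * ‖fderiv ℝ u x (EuclideanSpace.basisFun (Fin n) ℝ i)‖ := by
    rw [← sum_smul_apply_basisFun]
    refine (norm_sum_le _ _).trans (le_of_eq ?_)
    simp [norm_smul]
  have h2 : ‖v‖ ^ 2 = ∑ i, |v i| ^ 2 := by
    simp [EuclideanSpace.norm_sq_eq]
  rw [h2]
  exact (pow_le_pow_left₀ (norm_nonneg _) h1 2).trans (Finset.sum_mul_sq_le_sq_mul_sq _ _ _)

/-- The divergence theorem for compactly supported vector fields. -/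
theorem integral_sum_lineDeriv_eq_zero
    {V V' : Fin n → EuclideanSpace ℝ (Fin n) → ℝ}
    (hV : ∀ i x, HasLineDerivAt ℝ (V i) (V' i x) x (EuclideanSpace.basisFun (Fin n) ℝ i))
    (hVc : ∀ i, Continuous (V i)) (hVc' : ∀ i, Continuous (V' i))
    (hVs : ∀ i, HasCompactSupport (V i)) (hVs' : ∀ i, HasCompactSupport (V' i)) :
    ∫ x, ∑ i, V' i x = 0 := by
  rw [integral_finsetSum _ fun i _ => (hVc' i).integrable_of_hasCompactSupport (hVs' i)]
  refine Finset.sum_eq_zero fun i _ => ?_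
  -- Integration by parts against the constant function `1`.
  have := integral_bilinear_hasLineDerivAt_right_eq_neg_left_of_integrable
    (μ := (volume : Measure (EuclideanSpace ℝ (Fin n))))
    (f := fun _ => (1 : ℝ)) (f' := fun _ => (0 : ℝ)) (g := V i) (g' := V' i)
    (v := EuclideanSpace.basisFun (Fin n) ℝ i) (B := ContinuousLinearMap.mul ℝ ℝ)
    (by simp)
    (by simpa using (hVc' i).integrable_of_hasCompactSupport (hVs' i))
    (by simpa using (hVc i).integrable_of_hasCompactSupport (hVs i))
    (fun x _ => hasDerivAt_const _ _)
    (fun x _ => hV i x)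
  simpa using this

theorem hasCompactSupport_of_norm_sq {f : EuclideanSpace ℝ (Fin n) → ℝ} {S : ℝ}
    (h : ∀ x, S ≤ ‖x‖ ^ 2 → f x = 0) : HasCompactSupport f := by
  refine HasCompactSupport.intro (isCompact_closedBall 0 (Real.sqrt S)) fun x hx => h x ?_
  rw [mem_closedBall_zero_iff, not_le] at hx
  exact (Real.lt_sq_of_sqrt_lt hx).le

theorem hasDerivAt_line {G : Type*} [NormedAddCommGroup G] [NormedSpace ℝ G]
    {f : EuclideanSpace ℝ (Fin n) → G} {x v : EuclideanSpace ℝ (Fin n)}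
    (hf : DifferentiableAt ℝ f x) :
    HasDerivAt (fun t : ℝ => f (x + t • v)) (fderiv ℝ f x v) 0 :=
  hf.hasFDerivAt.hasLineDerivAt v

/-- The profile is differentiated only on `s ≥ 0`, since the weight `(1 + s)^(-α)` used later is
singular at `s = -1`. -/
theorem hasDerivAt_line_comp_norm_sq {φ φ' : ℝ → ℝ} (hφ : ∀ s, 0 ≤ s → HasDerivAt φ (φ' s) s)
    (x : EuclideanSpace ℝ (Fin n)) (i : Fin n) :
    HasDerivAt (fun t : ℝ => φ (‖x + t • EuclideanSpace.basisFun (Fin n) ℝ i‖ ^ 2))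
      (φ' (‖x‖ ^ 2) * (2 * x i)) 0 := by
  have h0 : HasDerivAt (fun t : ℝ => x + t • EuclideanSpace.basisFun (Fin n) ℝ i)
      (EuclideanSpace.basisFun (Fin n) ℝ i) 0 := by
    simpa using ((hasDerivAt_id (0 : ℝ)).smul_const
      (EuclideanSpace.basisFun (Fin n) ℝ i)).const_add x
  have h1 := h0.norm_sq
  have h2 := (hφ (‖x + (0 : ℝ) • EuclideanSpace.basisFun (Fin n) ℝ i‖ ^ 2) (sq_nonneg _)).comp 0 h1
  simpa [EuclideanSpace.inner_single_right, Function.comp_def] using h2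

theorem laplacian_eq_sum_fderiv_fderiv (u : EuclideanSpace ℝ (Fin n) → F)
    (x : EuclideanSpace ℝ (Fin n)) :
    Δ u x = ∑ i, fderiv ℝ (fderiv ℝ u) x (EuclideanSpace.basisFun (Fin n) ℝ i)
      (EuclideanSpace.basisFun (Fin n) ℝ i) := by
  rw [InnerProductSpace.laplacian_eq_iteratedFDeriv_orthonormalBasis u
    (EuclideanSpace.basisFun (Fin n) ℝ)]
  simp [iteratedFDeriv_two_apply]

variable {u : EuclideanSpace ℝ (Fin n) → F} (hu : ContDiff ℝ 2 u)
  {φ φ' : ℝ → ℝ} {S : ℝ} (hφ : ∀ s, 0 ≤ s → HasDerivAt φ (φ' s) s) (hφ' : ContinuousOn φ' (Set.Ici 0))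
  (hφ0 : ∀ s, S ≤ s → φ s = 0) (hφ0' : ∀ s, S ≤ s → φ' s = 0)

include hu hφ hφ' hφ0 hφ0' in
/-- Testing `Δ u` against `φ(|x|²) (u - Q)`. -/
theorem integral_gradSq_add_inner_laplacian (Q : F) :
    ∫ x, (φ (‖x‖ ^ 2) * (gradSq u x + ⟪u x - Q, Δ u x⟫_ℝ)
      + 2 * φ' (‖x‖ ^ 2) * ⟪u x - Q, fderiv ℝ u x x⟫_ℝ) = 0 := by
  set b := EuclideanSpace.basisFun (Fin n) ℝ with hb
  have hu1 : ContDiff ℝ 1 u := hu.of_le one_le_two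
  have hD : ContDiff ℝ 1 (fderiv ℝ u) := hu.fderiv_right (by norm_num)
  have hDc : Continuous (fderiv ℝ u) := hD.continuous
  have hHc : Continuous (fderiv ℝ (fderiv ℝ u)) := hD.continuous_fderiv one_ne_zero
  have huc := hu.continuous
  have hφc : Continuous fun x : EuclideanSpace ℝ (Fin n) => φ (‖x‖ ^ 2) :=
    continuous_iff_continuousAt.2 fun x => ContinuousAt.comp (f := fun x => ‖x‖ ^ 2)
      (hφ _ (sq_nonneg _)).continuousAt (by fun_prop)
  have hφc' : Continuous fun x : EuclideanSpace ℝ (Fin n) => φ' (‖x‖ ^ 2) :=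
    hφ'.comp_continuous (f := fun x : EuclideanSpace ℝ (Fin n) => ‖x‖ ^ 2) (by fun_prop)
      fun x => sq_nonneg ‖x‖
  have key := integral_sum_lineDeriv_eq_zero (n := n)
    (V := fun i x => φ (‖x‖ ^ 2) * ⟪u x - Q, fderiv ℝ u x (b i)⟫_ℝ)
    (V' := fun i x => φ' (‖x‖ ^ 2) * (2 * x i) * ⟪u x - Q, fderiv ℝ u x (b i)⟫_ℝ +
      φ (‖x‖ ^ 2) * (⟪u x - Q, fderiv ℝ (fderiv ℝ u) x (b i) (b i)⟫_ℝ +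
        ⟪fderiv ℝ u x (b i), fderiv ℝ u x (b i)⟫_ℝ))
    ?_ (fun i => hφc.mul (by fun_prop)) (fun i =>
      ((hφc'.mul (by fun_prop)).mul (by fun_prop)).add (hφc.mul (by fun_prop)))
    (fun i => hasCompactSupport_of_norm_sq (S := S) fun x hx => by simp [hφ0 _ hx])
    (fun i => hasCompactSupport_of_norm_sq (S := S) fun x hx => by simp [hφ0 _ hx, hφ0' _ hx])
  · rw [← key]
    refine integral_congr_ae (Eventually.of_forall fun x => ?_)
    simp only
    rw [laplacian_eq_sum_fderiv_fderiv, inner_sum, gradSq, ← sum_smul_apply_basisFun _ x,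
      inner_sum, ← Finset.sum_add_distrib, Finset.mul_sum, Finset.mul_sum,
      ← Finset.sum_add_distrib]
    refine Finset.sum_congr rfl fun i _ => ?_
    rw [real_inner_smul_right, real_inner_self_eq_norm_sq]
    ring
  · intro i x
    have h1 := hasDerivAt_line_comp_norm_sq hφ x i
    have h2 := (hasDerivAt_line (v := b i) (hu1.differentiable one_ne_zero x)).sub_const Q
    have h3 := (hasDerivAt_line (v := b i) (hD.differentiable one_ne_zero x)).clm_apply
      (hasDerivAt_const 0 (b i))
    have h4 := h1.fun_mul (h2.inner ℝ h3)
    exact h4.congr_deriv (by simp)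

include hu hφ hφ' hφ0 hφ0' in
/-- The Pohozaev identity with the radial vector field `φ(|x|²) x`. -/
theorem integral_pohozaev [CompleteSpace F] {W : F → ℝ} (hW : ContDiff ℝ 1 W)
    (hu_eq : ∀ x, Δ u x = ∇ W (u x)) :
    ∫ x, (φ (‖x‖ ^ 2) * ((n - 2) * energyDensity W u x + 2 * W (u x))
      - 2 * φ' (‖x‖ ^ 2) * (‖fderiv ℝ u x x‖ ^ 2 - ‖x‖ ^ 2 * energyDensity W u x)) = 0 := by
  set b := EuclideanSpace.basisFun (Fin n) ℝ with hb
  have hu1 : ContDiff ℝ 1 u := hu.of_le one_le_two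
  have hD : ContDiff ℝ 1 (fderiv ℝ u) := hu.fderiv_right (by norm_num)
  have hDc : Continuous (fderiv ℝ u) := hD.continuous
  have hHc : Continuous (fderiv ℝ (fderiv ℝ u)) := hD.continuous_fderiv one_ne_zero
  have huc := hu.continuous
  have hWc := hW.continuous
  have hφc : Continuous fun x : EuclideanSpace ℝ (Fin n) => φ (‖x‖ ^ 2) :=
    continuous_iff_continuousAt.2 fun x => ContinuousAt.comp (f := fun x => ‖x‖ ^ 2)
      (hφ _ (sq_nonneg _)).continuousAt (by fun_prop)
  have hφc' : Continuous fun x : EuclideanSpace ℝ (Fin n) => φ' (‖x‖ ^ 2) :=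
    hφ'.comp_continuous (f := fun x : EuclideanSpace ℝ (Fin n) => ‖x‖ ^ 2) (by fun_prop)
      fun x => sq_nonneg ‖x‖
  have hgc := continuous_gradSq hu1
  have hec : Continuous (energyDensity W u) := (hgc.div_const 2).add (hWc.comp huc)
  -- Here continuity of `∇ W ∘ u` is read off from the equation.
  have hlapc : Continuous fun x => ∇ W (u x) := by
    simp_rw [← hu_eq, laplacian_eq_sum_fderiv_fderiv]
    fun_prop
  set H := fderiv ℝ (fderiv ℝ u) with hH
  set D := fderiv ℝ u with hDdef
  have key := integral_sum_lineDeriv_eq_zero (n := n)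
    -- The field is the stress-energy tensor `⟨∂ᵢu, ∂ⱼu⟩ - δᵢⱼ e` contracted with `φ x`. Its
    -- divergence is minus the stated integrand, because `|∇u|² - n e = -((n - 2) e + 2 W)`.
    (V := fun i x => φ (‖x‖ ^ 2) * (⟪D x (b i), D x x⟫_ℝ - x i * energyDensity W u x))
    (V' := fun i x => φ' (‖x‖ ^ 2) * (2 * x i) *
        (⟪D x (b i), D x x⟫_ℝ - x i * energyDensity W u x) +
      φ (‖x‖ ^ 2) * (⟪D x (b i), H x (b i) x + D x (b i)⟫_ℝ + ⟪H x (b i) (b i), D x x⟫_ℝ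
        - (energyDensity W u x + x i * ((∑ j, ⟪D x (b j), H x (b i) (b j)⟫_ℝ)
          + ⟪∇ W (u x), D x (b i)⟫_ℝ))))
    ?_ (fun i => hφc.mul (by fun_prop)) (fun i =>
      ((hφc'.mul (by fun_prop)).mul (by fun_prop)).add (hφc.mul (by fun_prop)))
    (fun i => hasCompactSupport_of_norm_sq (S := S) fun x hx => by simp [hφ0 _ hx])
    (fun i => hasCompactSupport_of_norm_sq (S := S) fun x hx => by simp [hφ0 _ hx, hφ0' _ hx])
  · rw [← neg_eq_zero, ← integral_neg, ← key]
    refine integral_congr_ae (Eventually.of_forall fun x => ?_)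
    simp only
    have hsymm : ∀ v w, H x v w = H x w v :=
      (hu.contDiffAt.isSymmSndFDerivAt (x := x) (by simp)).eq
    have e1 : ∑ i, x i * ⟪D x (b i), D x x⟫_ℝ = ‖D x x‖ ^ 2 := by
      rw [← real_inner_self_eq_norm_sq, ← sum_smul_apply_basisFun (D x) x, sum_inner]
      simp [real_inner_smul_left, hb]
    have e2 : ∑ i, x i * x i = ‖x‖ ^ 2 := by
      rw [EuclideanSpace.norm_sq_eq]
      exact Finset.sum_congr rfl fun i _ => by rw [Real.norm_eq_abs, sq_abs, sq]
    -- The equation enters here: the Laplacian term cancels the derivative of `W ∘ u` computed in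
    -- `e4`.
    have e3 : ∑ i, ⟪H x (b i) (b i), D x x⟫_ℝ = ⟪∇ W (u x), D x x⟫_ℝ := by
      rw [← sum_inner, ← hu_eq, laplacian_eq_sum_fderiv_fderiv]
    have e4 : ∑ i, x i * ⟪∇ W (u x), D x (b i)⟫_ℝ = ⟪∇ W (u x), D x x⟫_ℝ := by
      rw [← sum_smul_apply_basisFun (D x) x, inner_sum]
      exact Finset.sum_congr rfl fun i _ => (real_inner_smul_right _ _ _).symm
    -- By symmetry of the Hessian, the derivative of `|∇u|²/2` along `x` cancels the
    -- second-derivative term coming from `D x x`.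
    have e5 : ∑ i, x i * ∑ j, ⟪D x (b j), H x (b i) (b j)⟫_ℝ
        = ∑ j, ⟪D x (b j), H x (b j) x⟫_ℝ := by
      simp_rw [Finset.mul_sum]
      rw [Finset.sum_comm]
      refine Finset.sum_congr rfl fun j _ => ?_
      rw [← sum_smul_apply_basisFun (H x (b j)) x, inner_sum]
      refine Finset.sum_congr rfl fun i _ => ?_
      rw [real_inner_smul_right, hsymm (b i) (b j)]
    have e6 : ∑ i, ⟪D x (b i), D x (b i)⟫_ℝ = gradSq u x := by
      simp [gradSq, hb, hDdef]
    have e7 : ∑ i : Fin n, energyDensity W u x = n * energyDensity W u x := by simp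
    have split : ∀ i, (φ' (‖x‖ ^ 2) * (2 * x i) *
        (⟪D x (b i), D x x⟫_ℝ - x i * energyDensity W u x) +
      φ (‖x‖ ^ 2) * (⟪D x (b i), H x (b i) x + D x (b i)⟫_ℝ + ⟪H x (b i) (b i), D x x⟫_ℝ
        - (energyDensity W u x + x i * ((∑ j, ⟪D x (b j), H x (b i) (b j)⟫_ℝ)
          + ⟪∇ W (u x), D x (b i)⟫_ℝ)))) =
      2 * φ' (‖x‖ ^ 2) * (x i * ⟪D x (b i), D x x⟫_ℝ - (x i * x i) * energyDensity W u x) +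
      φ (‖x‖ ^ 2) * (⟪D x (b i), H x (b i) x⟫_ℝ + ⟪D x (b i), D x (b i)⟫_ℝ
        + ⟪H x (b i) (b i), D x x⟫_ℝ - energyDensity W u x
        - x i * (∑ j, ⟪D x (b j), H x (b i) (b j)⟫_ℝ) - x i * ⟪∇ W (u x), D x (b i)⟫_ℝ) := by
      intro i
      rw [inner_add_right]
      ring
    rw [Finset.sum_congr rfl fun i _ => split i, Finset.sum_add_distrib, ← Finset.mul_sum,
      ← Finset.mul_sum, Finset.sum_sub_distrib, ← Finset.sum_mul, Finset.sum_sub_distrib,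
      Finset.sum_sub_distrib, Finset.sum_sub_distrib, Finset.sum_add_distrib,
      Finset.sum_add_distrib, e1, e2, e3, e4, e5, e6, e7]
    simp only [energyDensity]
    ring
  · intro i x
    have h1 := hasDerivAt_line_comp_norm_sq hφ x i
    have h0 : HasDerivAt (fun t : ℝ => x + t • b i) (b i) 0 := by
      simpa using ((hasDerivAt_id (0 : ℝ)).smul_const (b i)).const_add x
    have hl := hasDerivAt_line (v := b i) (hD.differentiable one_ne_zero x)
    have h2 : ∀ j, HasDerivAt (fun t : ℝ => D (x + t • b i) (b j)) (H x (b i) (b j)) 0 :=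
      fun j => by simpa using hl.clm_apply (hasDerivAt_const 0 (b j))
    have h3 : HasDerivAt (fun t : ℝ => D (x + t • b i) (x + t • b i))
        (H x (b i) x + D x (b i)) 0 := by simpa using hl.clm_apply h0
    have h4 : HasDerivAt (fun t : ℝ => (x + t • b i) i) 1 0 := by
      simpa [hb] using (hasDerivAt_id (0 : ℝ)).const_add (x i)
    have hWu : HasDerivAt (fun t : ℝ => W (u (x + t • b i))) ⟪∇ W (u x), D x (b i)⟫_ℝ 0 := by
      have hu' := hasDerivAt_line (v := b i) (hu1.differentiable one_ne_zero x)
      have hW' : HasFDerivAt W _ (u (x + (0 : ℝ) • b i)) :=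
        ((hW.differentiable one_ne_zero) _).hasGradientAt.hasFDerivAt
      exact (hW'.comp_hasDerivAt 0 hu').congr_deriv (by simp [D])
    have h5 : HasDerivAt (fun t : ℝ => energyDensity W u (x + t • b i))
        ((∑ j, ⟪D x (b j), H x (b i) (b j)⟫_ℝ) + ⟪∇ W (u x), D x (b i)⟫_ℝ) 0 := by
      have hs := HasDerivAt.fun_sum (u := Finset.univ) fun j _ => (h2 j).norm_sq
      refine ((hs.div_const 2).fun_add hWu).congr_deriv ?_
      simp [← Finset.mul_sum]
    have h6 := h1.fun_mul (((h2 i).inner ℝ h3).fun_sub (h4.fun_mul h5))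
    exact h6.congr_deriv (by simp)

end Identities

/-! ### Cutoff functions -/

/-- A `C¹` cutoff function on the line, equal to `1` before `1` and to `0` after `2`, together
with its derivative `ζ'` and a bound `L` for the latter. -/
structure IsCutoff (ζ ζ' : ℝ → ℝ) (L : ℝ) : Prop where
  hasDerivAt : ∀ s, HasDerivAt ζ (ζ' s) s
  continuous_deriv : Continuous ζ'
  nonneg : ∀ s, 0 ≤ ζ s
  le_one : ∀ s, ζ s ≤ 1
  eq_one : ∀ s, s ≤ 1 → ζ s = 1
  eq_zero : ∀ s, 2 ≤ s → ζ s = 0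
  deriv_of_le : ∀ s, s ≤ 1 → ζ' s = 0
  deriv_of_ge : ∀ s, 2 ≤ s → ζ' s = 0
  abs_deriv_le : ∀ s, |ζ' s| ≤ L

theorem exists_isCutoff : ∃ ζ ζ' L, IsCutoff ζ ζ' L := by
  set ζ : ℝ → ℝ := fun s => Real.smoothTransition (2 - s) with hζ
  have hsm : ContDiff ℝ 1 ζ := Real.smoothTransition.contDiff.comp (by fun_prop)
  have hd : ∀ s, HasDerivAt ζ (deriv ζ s) s := fun s =>
    (hsm.differentiable one_ne_zero s).hasDerivAt
  have hc : Continuous (deriv ζ) := hsm.continuous_deriv_one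
  have h1 : ∀ s, s ≤ 1 → ζ s = 1 := fun s hs =>
    Real.smoothTransition.one_of_one_le (by linarith)
  have h0 : ∀ s, 2 ≤ s → ζ s = 0 := fun s hs =>
    Real.smoothTransition.zero_of_nonpos (by linarith)
  have hle : ∀ s, s ≤ 1 → deriv ζ s = 0 := by
    -- Local constancy gives the claim only on the open half-line; continuity of `deriv ζ` adds the
    -- endpoint.
    have : Set.EqOn (deriv ζ) (fun _ => 0) (closure (Set.Iio 1)) := by
      refine Set.EqOn.closure (fun s hs => ?_) hc continuous_const
      have : ζ =ᶠ[𝓝 s] fun _ => 1 := by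
        filter_upwards [Iio_mem_nhds hs] with t ht using h1 t (le_of_lt ht)
      simpa using this.deriv_eq
    intro s hs
    exact this (by simpa using hs)
  have hge : ∀ s, 2 ≤ s → deriv ζ s = 0 := by
    have : Set.EqOn (deriv ζ) (fun _ => 0) (closure (Set.Ioi 2)) := by
      refine Set.EqOn.closure (fun s hs => ?_) hc continuous_const
      have : ζ =ᶠ[𝓝 s] fun _ => 0 := by
        filter_upwards [Ioi_mem_nhds hs] with t ht using h0 t (le_of_lt ht)
      simpa using this.deriv_eq
    intro s hs
    exact this (by simpa using hs)
  obtain ⟨L, hL⟩ := (isCompact_Icc (a := (1 : ℝ)) (b := 2)).exists_bound_of_continuousOn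
    hc.continuousOn
  refine ⟨ζ, deriv ζ, L, hd, hc, fun s => Real.smoothTransition.nonneg _,
    fun s => Real.smoothTransition.le_one _, h1, h0, hle, hge, fun s => ?_⟩
  have hL0 : 0 ≤ L := (norm_nonneg _).trans (hL 1 (by norm_num))
  rcases le_or_gt s 1 with h | h
  · simpa [hle s h] using hL0
  rcases le_or_gt 2 s with h' | h'
  · simpa [hge s h'] using hL0
  · exact hL s ⟨h.le, h'.le⟩

section Scaling

variable {ζ ζ' : ℝ → ℝ} {L : ℝ}

theorem IsCutoff.bound_nonneg (h : IsCutoff ζ ζ' L) : 0 ≤ L :=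
  (abs_nonneg _).trans (h.abs_deriv_le 0)

theorem IsCutoff.continuous (h : IsCutoff ζ ζ' L) : Continuous ζ :=
  continuous_iff_continuousAt.2 fun s => (h.hasDerivAt s).continuousAt

theorem IsCutoff.hasDerivAt_scaled_sq (h : IsCutoff ζ ζ' L) (R s : ℝ) :
    HasDerivAt (fun s => ζ (s / R ^ 2) ^ 2)
      (2 * ζ (s / R ^ 2) * ζ' (s / R ^ 2) / R ^ 2) s := by
  have h1 : HasDerivAt (fun s : ℝ => s / R ^ 2) (1 / R ^ 2) s := (hasDerivAt_id s).div_const _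
  have h2 := ((h.hasDerivAt (s / R ^ 2)).comp s h1).fun_pow 2
  refine h2.congr_deriv ?_
  simp
  ring

end Scaling

/-! ### Integrals over balls -/

section Balls

variable {n : ℕ}

theorem Continuous.integrableOn_euclidean_ball {f : EuclideanSpace ℝ (Fin n) → ℝ}
    (hf : Continuous f) (R : ℝ) : IntegrableOn f (Metric.ball 0 R) :=
  (hf.continuousOn.integrableOn_compact (isCompact_closedBall 0 R)).mono_set
    Metric.ball_subset_closedBall

theorem setIntegral_ball_nonneg {f : EuclideanSpace ℝ (Fin n) → ℝ} (hf : ∀ x, 0 ≤ f x) (R : ℝ) :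
    0 ≤ ∫ x in Metric.ball 0 R, f x :=
  integral_nonneg hf

theorem monotone_setIntegral_ball {f : EuclideanSpace ℝ (Fin n) → ℝ} (hf : Continuous f)
    (hf0 : ∀ x, 0 ≤ f x) : Monotone fun R => ∫ x in Metric.ball 0 R, f x := fun _ R' h =>
  setIntegral_mono_set (hf.integrableOn_euclidean_ball R') (ae_of_all _ hf0)
    (LE.le.eventuallyLE (Metric.ball_subset_ball h))

theorem measureReal_ball_eq (R : ℝ) (hR : 0 < R) :
    (volume : Measure (EuclideanSpace ℝ (Fin n))).real (Metric.ball 0 R) =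
      R ^ n * (volume : Measure (EuclideanSpace ℝ (Fin n))).real (Metric.ball 0 1) := by
  rw [measureReal_def, Measure.addHaar_ball_of_pos _ _ hR, ENNReal.toReal_mul,
    finrank_euclideanSpace_fin, ENNReal.toReal_ofReal (by positivity), measureReal_def]

/-- A pointwise bound modulo a function `I` of vanishing integral supported in `ball 0 (2 * R)`
gives an integral bound. -/
theorem setIntegral_ball_le_of_integral_eq_zero {f I g : EuclideanSpace ℝ (Fin n) → ℝ} {R : ℝ}
    (hR : 0 < R) (hf : Continuous f) (hI : Continuous I)
    (hg : IntegrableOn g (Metric.ball 0 (2 * R)))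
    (hI0 : ∫ x, I x = 0) (hIs : ∀ x, 2 * R ^ 2 ≤ ‖x‖ ^ 2 → I x = 0)
    (h1 : ∀ x, ‖x‖ ^ 2 ≤ R ^ 2 → f x ≤ I x + g x)
    (h2 : ∀ x, ‖x‖ ^ 2 ≤ (2 * R) ^ 2 → 0 ≤ I x + g x) :
    ∫ x in Metric.ball 0 R, f x ≤ ∫ x in Metric.ball 0 (2 * R), g x := by
  have hsub : Metric.ball (0 : EuclideanSpace ℝ (Fin n)) R ⊆ Metric.ball 0 (2 * R) :=
    Metric.ball_subset_ball (by linarith)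
  have hmem : ∀ {r : ℝ} {x : EuclideanSpace ℝ (Fin n)}, x ∈ Metric.ball 0 r →
      ‖x‖ ^ 2 ≤ r ^ 2 := fun hx =>
    pow_le_pow_left₀ (norm_nonneg _) (mem_ball_zero_iff.1 hx).le 2
  have hIi := hI.integrableOn_euclidean_ball (2 * R)
  have hsum : IntegrableOn (fun x => I x + g x) (Metric.ball 0 (2 * R)) := hIi.add hg
  calc ∫ x in Metric.ball 0 R, f x ≤ ∫ x in Metric.ball 0 R, (I x + g x) :=
        setIntegral_mono_on (hf.integrableOn_euclidean_ball R) (hsum.mono_set hsub)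
          measurableSet_ball fun x hx => h1 x (hmem hx)
    _ ≤ ∫ x in Metric.ball 0 (2 * R), (I x + g x) := by
        refine setIntegral_mono_set hsum ?_ (LE.le.eventuallyLE hsub)
        exact (ae_restrict_iff' measurableSet_ball).2 (ae_of_all _ fun x hx => h2 x (hmem hx))
    _ = (∫ x in Metric.ball 0 (2 * R), I x) + ∫ x in Metric.ball 0 (2 * R), g x :=
        integral_add hIi hg
    _ = ∫ x in Metric.ball 0 (2 * R), g x := by
        rw [setIntegral_eq_integral_of_forall_compl_eq_zero, hI0, zero_add]
        intro x hx
        -- The cutoff acts on `|x|²/R²`, so the support lies in `|x| ≤ √2 R`, inside the ball of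
        -- radius `2R`.
        refine hIs x ?_
        rw [mem_ball_zero_iff, not_lt] at hx
        nlinarith

end Balls

/-! ### Caccioppoli inequalities -/

section Estimates

variable {n : ℕ} {F : Type*} [NormedAddCommGroup F] [InnerProductSpace ℝ F]
  {u : EuclideanSpace ℝ (Fin n) → F} {ζ ζ' : ℝ → ℝ} {L M R : ℝ} {Q : F} {k : F → ℝ}

theorem continuous_laplacian (hu : ContDiff ℝ 2 u) : Continuous (Δ u) := by
  have hD : ContDiff ℝ 1 (fderiv ℝ u) := hu.fderiv_right (by norm_num)
  have hHc : Continuous (fderiv ℝ (fderiv ℝ u)) := hD.continuous_fderiv one_ne_zero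
  rw [funext (laplacian_eq_sum_fderiv_fderiv u)]
  fun_prop

/-- The quantity integrated in the Caccioppoli inequality, with cutoff at scale `R`. -/
noncomputable def caccioppoliIntegrand (u : EuclideanSpace ℝ (Fin n) → F) (Q : F) (ζ ζ' : ℝ → ℝ)
    (R : ℝ) (x : EuclideanSpace ℝ (Fin n)) : ℝ :=
  ζ (‖x‖ ^ 2 / R ^ 2) ^ 2 * (gradSq u x + ⟪u x - Q, Δ u x⟫_ℝ)
    + 2 * (2 * ζ (‖x‖ ^ 2 / R ^ 2) * ζ' (‖x‖ ^ 2 / R ^ 2) / R ^ 2) *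
      ⟪u x - Q, fderiv ℝ u x x⟫_ℝ

theorem continuous_caccioppoliIntegrand (hu : ContDiff ℝ 2 u) (hζ : IsCutoff ζ ζ' L) :
    Continuous (caccioppoliIntegrand u Q ζ ζ' R) := by
  have := continuous_gradSq (hu.of_le one_le_two)
  have := hu.continuous
  have := hu.continuous_fderiv two_ne_zero
  have := continuous_laplacian hu
  have := hζ.continuous
  have := hζ.continuous_deriv
  unfold caccioppoliIntegrand
  fun_prop

theorem integral_caccioppoliIntegrand (hu : ContDiff ℝ 2 u) (hζ : IsCutoff ζ ζ' L)
    (hR : 0 < R) : ∫ x, caccioppoliIntegrand u Q ζ ζ' R x = 0 := by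
  have := hζ.continuous
  have := hζ.continuous_deriv
  have hs : ∀ s, 2 * R ^ 2 ≤ s → 2 ≤ s / R ^ 2 := fun s hs => by
    rwa [le_div_iff₀ (by positivity)]
  exact integral_gradSq_add_inner_laplacian hu (φ := fun s => ζ (s / R ^ 2) ^ 2)
    (φ' := fun s => 2 * ζ (s / R ^ 2) * ζ' (s / R ^ 2) / R ^ 2) (S := 2 * R ^ 2)
    (fun s _ => hζ.hasDerivAt_scaled_sq R s) (Continuous.continuousOn (by fun_prop)) (fun s h => by simp [hζ.eq_zero _ (hs s h)])
    (fun s h => by simp [hζ.eq_zero _ (hs s h)]) Q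

theorem caccioppoliIntegrand_eq_zero (hζ : IsCutoff ζ ζ' L) (hR : 0 < R)
    (x : EuclideanSpace ℝ (Fin n)) (hx : 2 * R ^ 2 ≤ ‖x‖ ^ 2) :
    caccioppoliIntegrand u Q ζ ζ' R x = 0 := by
  have : 2 ≤ ‖x‖ ^ 2 / R ^ 2 := by rwa [le_div_iff₀ (by positivity)]
  simp [caccioppoliIntegrand, hζ.eq_zero _ this]

theorem gradSq_le_caccioppoliIntegrand (hζ : IsCutoff ζ ζ' L) (hR : 0 < R)
    (hk : ∀ x, -⟪u x - Q, Δ u x⟫_ℝ ≤ k (u x))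
    (x : EuclideanSpace ℝ (Fin n)) (hx : ‖x‖ ^ 2 ≤ R ^ 2) :
    gradSq u x ≤ caccioppoliIntegrand u Q ζ ζ' R x + k (u x) := by
  have : ‖x‖ ^ 2 / R ^ 2 ≤ 1 := by rwa [div_le_one (by positivity)]
  have := hk x
  simp only [caccioppoliIntegrand, hζ.eq_one _ ‹_›, hζ.deriv_of_le _ ‹_›]
  simp
  linarith

/-- On the support of the derivative of the cutoff only the radial derivative enters. -/
theorem sq_mul_gradSq_le_caccioppoliIntegrand (hζ : IsCutoff ζ ζ' L)
    (hk0 : ∀ v, 0 ≤ k v) (hk : ∀ x, -⟪u x - Q, Δ u x⟫_ℝ ≤ k (u x))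
    (hM : ∀ x, ‖u x - Q‖ ≤ M) (x : EuclideanSpace ℝ (Fin n)) :
    ζ (‖x‖ ^ 2 / R ^ 2) ^ 2 * gradSq u x ≤ caccioppoliIntegrand u Q ζ ζ' R x + k (u x)
      + 4 * M * L / R ^ 2 * (ζ (‖x‖ ^ 2 / R ^ 2) * ‖fderiv ℝ u x x‖) := by
  have h0 := hζ.nonneg (‖x‖ ^ 2 / R ^ 2)
  have h1 := hζ.le_one (‖x‖ ^ 2 / R ^ 2)
  have hL := hζ.abs_deriv_le (‖x‖ ^ 2 / R ^ 2)
  unfold caccioppoliIntegrand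
  set z := ζ (‖x‖ ^ 2 / R ^ 2)
  set z' := ζ' (‖x‖ ^ 2 / R ^ 2)
  have hin : |⟪u x - Q, fderiv ℝ u x x⟫_ℝ| ≤ M * ‖fderiv ℝ u x x‖ :=
    (abs_real_inner_le_norm _ _).trans (mul_le_mul_of_nonneg_right (hM x) (norm_nonneg _))
  have hA : z ^ 2 * -⟪u x - Q, Δ u x⟫_ℝ ≤ k (u x) := by
    have hz : z ^ 2 ≤ 1 := pow_le_one₀ h0 h1
    calc z ^ 2 * -⟪u x - Q, Δ u x⟫_ℝ ≤ z ^ 2 * k (u x) :=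
          mul_le_mul_of_nonneg_left (hk x) (sq_nonneg z)
      _ ≤ k (u x) := mul_le_of_le_one_left (hk0 _) hz
  have hB : -(z' * ⟪u x - Q, fderiv ℝ u x x⟫_ℝ) ≤ L * (M * ‖fderiv ℝ u x x‖) := by
    refine (neg_le_abs _).trans ?_
    rw [abs_mul]
    exact mul_le_mul hL hin (abs_nonneg _) hζ.bound_nonneg
  have hC := mul_le_mul_of_nonneg_left hB (show 0 ≤ 4 * z / R ^ 2 by positivity)
  have e1 : 2 * (2 * z * z' / R ^ 2) * ⟪u x - Q, fderiv ℝ u x x⟫_ℝ =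
      4 * z / R ^ 2 * (z' * ⟪u x - Q, fderiv ℝ u x x⟫_ℝ) := by ring
  have e2 : 4 * M * L / R ^ 2 * (z * ‖fderiv ℝ u x x‖) =
      4 * z / R ^ 2 * (L * (M * ‖fderiv ℝ u x x‖)) := by ring
  rw [e1, e2]
  linarith

/-- **Caccioppoli inequality** for bounded solutions. -/
theorem setIntegral_gradSq_le (hu : ContDiff ℝ 2 u) (hζ : IsCutoff ζ ζ' L) (hR : 0 < R)
    (hkc : Continuous k) (hk0 : ∀ v, 0 ≤ k v) (hk : ∀ x, -⟪u x - Q, Δ u x⟫_ℝ ≤ k (u x))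
    (hM : ∀ x, ‖u x - Q‖ ≤ M) :
    ∫ x in Metric.ball 0 R, gradSq u x ≤ (∫ x in Metric.ball 0 (2 * R), k (u x)) +
      16 * (M * L) ^ 2 / R ^ 2 *
        (volume : Measure (EuclideanSpace ℝ (Fin n))).real (Metric.ball 0 (2 * R)) := by
  have hku : Continuous fun x => k (u x) := hkc.comp hu.continuous
  have hc : (0 : ℝ) ≤ 16 * (M * L) ^ 2 / R ^ 2 := by positivity
  have key := setIntegral_ball_le_of_integral_eq_zero hR
    (f := gradSq u) (I := caccioppoliIntegrand u Q ζ ζ' R)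
    (g := fun x => k (u x) + 16 * (M * L) ^ 2 / R ^ 2) (continuous_gradSq (hu.of_le one_le_two))
    (continuous_caccioppoliIntegrand hu hζ)
    ((hku.add continuous_const).integrableOn_euclidean_ball _)
    (integral_caccioppoliIntegrand hu hζ hR)
    (caccioppoliIntegrand_eq_zero hζ hR)
    (fun x hx => by
      have := gradSq_le_caccioppoliIntegrand hζ hR hk x hx
      linarith)
    (fun x hx => by
      have h1 := sq_mul_gradSq_le_caccioppoliIntegrand (R := R) hζ hk0 hk hM x
      have h2 := norm_fderiv_apply_sq_le u x x
      have hg := gradSq_nonneg u x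
      set z := ζ (‖x‖ ^ 2 / R ^ 2)
      set N := ‖fderiv ℝ u x x‖
      have h3 : N ^ 2 ≤ (2 * R) ^ 2 * gradSq u x := h2.trans
        (mul_le_mul_of_nonneg_right hx hg)
      have h4 : z ^ 2 * (N / (2 * R)) ^ 2 ≤ z ^ 2 * gradSq u x := by
        refine mul_le_mul_of_nonneg_left ?_ (sq_nonneg _)
        rw [div_pow, div_le_iff₀ (by positivity)]
        linarith
      -- Young's inequality, weighted so that the quadratic term is absorbed by `z² |∇u|²` through
      -- `h4`; the remaining square produces the constant `16`.
      have h5 : 4 * M * L / R ^ 2 * (z * N) ≤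
          z ^ 2 * (N / (2 * R)) ^ 2 + 16 * (M * L) ^ 2 / R ^ 2 := by
        have e : z ^ 2 * (N / (2 * R)) ^ 2 + 16 * (M * L) ^ 2 / R ^ 2
          - 4 * M * L / R ^ 2 * (z * N) = (z * N / (2 * R) - 4 * (M * L) / R) ^ 2 := by
          field_simp
          ring
        nlinarith [sq_nonneg (z * N / (2 * R) - 4 * (M * L) / R)]
      linarith)
  refine key.trans (le_of_eq ?_)
  rw [integral_add (hku.integrableOn_euclidean_ball _)
    (continuous_const.integrableOn_euclidean_ball _), setIntegral_const, smul_eq_mul]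
  ring

/-- The weighted square of the radial derivative. -/
noncomputable def radialDensity (u : EuclideanSpace ℝ (Fin n) → F)
    (x : EuclideanSpace ℝ (Fin n)) : ℝ :=
  (1 + ‖x‖ ^ 2) ^ (-((n : ℝ) / 2)) * ‖fderiv ℝ u x x‖ ^ 2

theorem continuous_weight (a : ℝ) :
    Continuous fun x : EuclideanSpace ℝ (Fin n) => (1 + ‖x‖ ^ 2) ^ a := by
  refine Continuous.rpow_const (by fun_prop) fun x => Or.inl ?_
  positivity

theorem continuous_radialDensity (hu : ContDiff ℝ 1 u) : Continuous (radialDensity u) := by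
  have := hu.continuous_fderiv one_ne_zero
  exact (continuous_weight _).mul (by fun_prop)

theorem radialDensity_nonneg (x : EuclideanSpace ℝ (Fin n)) : 0 ≤ radialDensity u x := by
  unfold radialDensity
  positivity

/-- Undoing the weight costs `(1 + |x|²)^(n/2)`, and `1 + |x|² ≤ 1 + 4R² ≤ 5R²` when `R ≥ 1`. -/
theorem norm_fderiv_apply_self_sq_le_radialDensity (hR : 1 ≤ R) (x : EuclideanSpace ℝ (Fin n))
    (hx : ‖x‖ ^ 2 ≤ (2 * R) ^ 2) :
    ‖fderiv ℝ u x x‖ ^ 2 ≤ (5 : ℝ) ^ ((n : ℝ) / 2) * R ^ n * radialDensity u x := by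
  have h0 : (0 : ℝ) < 1 + ‖x‖ ^ 2 := by positivity
  have h1 : (1 + ‖x‖ ^ 2) ^ ((n : ℝ) / 2) ≤ (5 : ℝ) ^ ((n : ℝ) / 2) * R ^ n := by
    have e : (R ^ 2) ^ ((n : ℝ) / 2) = R ^ n := by
      rw [← Real.rpow_natCast_mul (by linarith), ← Real.rpow_natCast R n]
      congr 1
      push_cast
      ring
    rw [← e, ← Real.mul_rpow (by norm_num) (by positivity)]
    exact Real.rpow_le_rpow h0.le (by nlinarith) (by positivity)
  have h2 : ‖fderiv ℝ u x x‖ ^ 2 = (1 + ‖x‖ ^ 2) ^ ((n : ℝ) / 2) * radialDensity u x := by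
    rw [radialDensity, ← mul_assoc, ← Real.rpow_add h0]
    simp
  rw [h2]
  exact mul_le_mul_of_nonneg_right h1 (radialDensity_nonneg x)

/-- The gradient term is controlled by the radial derivative on an annulus. -/
theorem setIntegral_gradSq_le_radial (hu : ContDiff ℝ 2 u) (hζ : IsCutoff ζ ζ' L) (hR : 1 ≤ R)
    (hkc : Continuous k) (hk0 : ∀ v, 0 ≤ k v) (hk : ∀ x, -⟪u x - Q, Δ u x⟫_ℝ ≤ k (u x))
    (hM0 : 0 ≤ M) (hM : ∀ x, ‖u x - Q‖ ≤ M) {ε : ℝ} (hε : 0 < ε) :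
    ∫ x in Metric.ball 0 R, gradSq u x ≤ (∫ x in Metric.ball 0 (2 * R), k (u x)) +
      4 * M * L / R ^ 2 *
        (ε * (volume : Measure (EuclideanSpace ℝ (Fin n))).real (Metric.ball 0 (2 * R)) +
          (5 : ℝ) ^ ((n : ℝ) / 2) * R ^ n / ε *
            ((∫ x in Metric.ball 0 (2 * R), radialDensity u x) -
              ∫ x in Metric.ball 0 R, radialDensity u x)) := by
  have hR0 : 0 < R := by linarith
  have hL := hζ.bound_nonneg
  have hku : Continuous fun x => k (u x) := hkc.comp hu.continuous
  have hh : Continuous (radialDensity u) := continuous_radialDensity (hu.of_le one_le_two)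
  have hhi := hh.integrableOn_euclidean_ball (2 * R)
  set c : ℝ := 4 * M * L / R ^ 2 with hc
  have hc0 : 0 ≤ c := by positivity
  set d : ℝ := (5 : ℝ) ^ ((n : ℝ) / 2) * R ^ n / ε with hd
  have hd0 : 0 ≤ d := by positivity
  -- Subtracting `J` leaves the radial density on the annulus only, so its integral is a difference
  -- of two ball integrals.
  set J : EuclideanSpace ℝ (Fin n) → ℝ := (Metric.ball 0 R).indicator (radialDensity u) with hJ
  have hJi : IntegrableOn J (Metric.ball 0 (2 * R)) := hhi.indicator measurableSet_ball
  have hJle : ∀ x, J x ≤ radialDensity u x := fun x =>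
    Set.indicator_le_self' (fun _ _ => radialDensity_nonneg x) x
  have hi1 : IntegrableOn (fun x => radialDensity u x - J x) (Metric.ball 0 (2 * R)) :=
    hhi.sub hJi
  have hconst : IntegrableOn (fun _ : EuclideanSpace ℝ (Fin n) => ε) (Metric.ball 0 (2 * R)) :=
    continuous_const.integrableOn_euclidean_ball _
  have hi2 : IntegrableOn (fun x => ε + d * (radialDensity u x - J x))
      (Metric.ball 0 (2 * R)) := hconst.add (hi1.const_mul d)
  have hnn : ∀ x, 0 ≤ c * (ε + d * (radialDensity u x - J x)) := fun x =>
    mul_nonneg hc0 (add_nonneg hε.le (mul_nonneg hd0 (sub_nonneg.2 (hJle x))))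
  have key := setIntegral_ball_le_of_integral_eq_zero hR0
    (f := gradSq u) (I := caccioppoliIntegrand u Q ζ ζ' R)
    (g := fun x => k (u x) + c * (ε + d * (radialDensity u x - J x)))
    (continuous_gradSq (hu.of_le one_le_two))
    (continuous_caccioppoliIntegrand hu hζ)
    ((hku.integrableOn_euclidean_ball _).add (hi2.const_mul c))
    (integral_caccioppoliIntegrand hu hζ hR0)
    (caccioppoliIntegrand_eq_zero hζ hR0)
    (fun x hx => by
      have := gradSq_le_caccioppoliIntegrand hζ hR0 hk x hx
      linarith [hnn x])
    (fun x hx => by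
      by_cases hxR : x ∈ Metric.ball 0 R
      · have := gradSq_le_caccioppoliIntegrand hζ hR0 hk x
          (pow_le_pow_left₀ (norm_nonneg _) (mem_ball_zero_iff.1 hxR).le 2)
        linarith [hnn x, gradSq_nonneg u x]
      have hJ0 : J x = 0 := Set.indicator_of_notMem hxR _
      have h1 := sq_mul_gradSq_le_caccioppoliIntegrand (R := R) hζ hk0 hk hM x
      have h2 := norm_fderiv_apply_self_sq_le_radialDensity (u := u) hR x hx
      have h3 : 0 ≤ ζ (‖x‖ ^ 2 / R ^ 2) ^ 2 * gradSq u x :=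
        mul_nonneg (sq_nonneg _) (gradSq_nonneg u x)
      have h4 : ζ (‖x‖ ^ 2 / R ^ 2) * ‖fderiv ℝ u x x‖ ≤ ε + d * (radialDensity u x - J x) := by
        refine (mul_le_of_le_one_left (norm_nonneg _) (hζ.le_one _)).trans ?_
        have h5 : d * (radialDensity u x - J x) =
            (5 : ℝ) ^ ((n : ℝ) / 2) * R ^ n * radialDensity u x / ε := by
          rw [hJ0, hd]
          ring
        -- This trades the linear radial term for its square; the free parameter `ε` later makes the
        -- volume contribution small.
        have h6 : ‖fderiv ℝ u x x‖ ≤ ε + ‖fderiv ℝ u x x‖ ^ 2 / ε := by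
          rw [← sub_le_iff_le_add', le_div_iff₀ hε]
          nlinarith [sq_nonneg (‖fderiv ℝ u x x‖ - ε), norm_nonneg (fderiv ℝ u x x)]
        rw [h5]
        exact h6.trans (by gcongr)
      have h7 := mul_le_mul_of_nonneg_left h4 hc0
      linarith)
  refine key.trans (le_of_eq ?_)
  have hJint : ∫ x in Metric.ball 0 (2 * R), J x = ∫ x in Metric.ball 0 R, radialDensity u x := by
    rw [hJ, setIntegral_indicator measurableSet_ball,
      Set.inter_eq_right.2 (Metric.ball_subset_ball (by linarith))]
  rw [integral_add (hku.integrableOn_euclidean_ball _) (hi2.const_mul c), integral_const_mul,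
    integral_add hconst (hi1.const_mul d), integral_const_mul, integral_sub hhi hJi, hJint,
    setIntegral_const, smul_eq_mul]
  ring

end Estimates

/-! ### Weighted monotonicity from the Pohozaev identity -/

section Pohozaev

variable {n : ℕ} {F : Type*} [NormedAddCommGroup F] [InnerProductSpace ℝ F]
  {u : EuclideanSpace ℝ (Fin n) → F} {ζ ζ' : ℝ → ℝ} {L M R : ℝ} {Q : F} {W k : F → ℝ}

theorem continuous_energyDensity (hu : ContDiff ℝ 1 u) (hW : Continuous W) :
    Continuous (energyDensity W u) :=
  ((continuous_gradSq hu).div_const 2).add (hW.comp hu.continuous)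

theorem energyDensity_nonneg (hW0 : ∀ v, 0 ≤ W v) (x : EuclideanSpace ℝ (Fin n)) :
    0 ≤ energyDensity W u x :=
  add_nonneg (div_nonneg (gradSq_nonneg u x) zero_le_two) (hW0 _)

theorem norm_fderiv_apply_self_sq_le_energyDensity (hW0 : ∀ v, 0 ≤ W v)
    (x : EuclideanSpace ℝ (Fin n)) :
    ‖fderiv ℝ u x x‖ ^ 2 ≤ 2 * (‖x‖ ^ 2 * energyDensity W u x) := by
  refine (norm_fderiv_apply_sq_le u x x).trans ?_
  have := mul_nonneg (sq_nonneg ‖x‖) (hW0 (u x))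
  simp only [energyDensity]
  linarith

/-- A weighted monotonicity inequality: the weighted energy and the weighted radial derivative on
`ball 0 R` are bounded by the rescaled energy on `ball 0 (2 * R)`. -/
theorem setIntegral_weighted_energy_le [CompleteSpace F] (hn : 2 ≤ n) (hu : ContDiff ℝ 2 u)
    (hW : ContDiff ℝ 1 W) (hW0 : ∀ v, 0 ≤ W v) (hu_eq : ∀ x, Δ u x = ∇ W (u x))
    (hζ : IsCutoff ζ ζ' L) (hR : 0 < R) :
    ∫ x in Metric.ball 0 R, ((n : ℝ) - 2) *
        ((1 + ‖x‖ ^ 2) ^ (-((n : ℝ) / 2)) * energyDensity W u x + radialDensity u x) ≤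
      16 * L / R ^ (n - 2) * ∫ x in Metric.ball 0 (2 * R), energyDensity W u x := by
  have hn2 : (0 : ℝ) ≤ n - 2 := by
    have : (2 : ℝ) ≤ n := by exact_mod_cast hn
    linarith
  -- With this exponent `2 w' = -(n - 2) (1 + s)^(-n/2)`. Without the cutoff, the energy terms
  -- combine through `(1 + s) - s = 1`, leaving `(n - 2) (1 + s)^(-n/2)` times the sum of `e` and
  -- `‖fderiv ℝ u x x‖²`.
  set α : ℝ := ((n : ℝ) - 2) / 2 with hα
  have hα0 : 0 ≤ α := by positivity
  have hL := hζ.bound_nonneg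
  have hu1 : ContDiff ℝ 1 u := hu.of_le one_le_two
  have hec : Continuous (energyDensity W u) := continuous_energyDensity hu1 hW.continuous
  have hDc := hu.continuous_fderiv two_ne_zero
  have hζc := hζ.continuous
  have hζc' := hζ.continuous_deriv
  have hWu : Continuous fun x => W (u x) := hW.continuous.comp hu.continuous
  have hpow : (R ^ 2) ^ (-α) = (R ^ (n - 2))⁻¹ := by
    rw [← Real.rpow_natCast_mul hR.le, ← Real.rpow_natCast R (n - 2), ← Real.rpow_neg hR.le,
      Nat.cast_sub hn, hα]
    congr 1
    push_cast
    ring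
  set w : ℝ → ℝ := fun s => (1 + s) ^ (-α) with hw
  set w' : ℝ → ℝ := fun s => -α * (1 + s) ^ (-((n : ℝ) / 2)) with hw'
  have hwd : ∀ s, 0 ≤ s → HasDerivAt w (w' s) s := fun s hs => by
    have := ((hasDerivAt_id s).const_add 1).rpow_const (p := -α)
      (Or.inl (by simp only [id]; positivity))
    refine this.congr_deriv ?_
    have e : -α - 1 = -((n : ℝ) / 2) := by rw [hα]; ring
    simp [hw', e]
  have hwc : ContinuousOn w (Set.Ici 0) := fun s hs => (hwd s hs).continuousAt.continuousWithinAt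
  have hwc' : ContinuousOn w' (Set.Ici 0) := by
    refine continuousOn_const.mul (ContinuousOn.rpow_const (by fun_prop) fun s hs => Or.inl ?_)
    have : (0 : ℝ) ≤ s := hs
    positivity
  set φ : ℝ → ℝ := fun s => w s * ζ (s / R ^ 2) ^ 2 with hφ
  set φ' : ℝ → ℝ := fun s => w' s * ζ (s / R ^ 2) ^ 2 +
    w s * (2 * ζ (s / R ^ 2) * ζ' (s / R ^ 2) / R ^ 2) with hφ'
  have hs : ∀ s, 2 * R ^ 2 ≤ s → ζ (s / R ^ 2) = 0 := fun s hs =>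
    hζ.eq_zero _ (by rwa [le_div_iff₀ (by positivity)])
  have hφd : ∀ s, 0 ≤ s → HasDerivAt φ (φ' s) s := fun s hs =>
    (hwd s hs).fun_mul (hζ.hasDerivAt_scaled_sq R s)
  have hφc' : ContinuousOn φ' (Set.Ici 0) :=
    (hwc'.mul (Continuous.continuousOn (by fun_prop))).add
      (hwc.mul (Continuous.continuousOn (by fun_prop)))
  have hφ0 : ∀ s, 2 * R ^ 2 ≤ s → φ s = 0 := fun s h => by simp [hφ, hs s h]
  have hφ0' : ∀ s, 2 * R ^ 2 ≤ s → φ' s = 0 := fun s h => by simp [hφ', hs s h]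
  have hpoh := integral_pohozaev hu hφd hφc' hφ0 hφ0' hW hu_eq
  have hφxc : Continuous fun x : EuclideanSpace ℝ (Fin n) => φ (‖x‖ ^ 2) :=
    ContinuousOn.comp_continuous (s := Set.Ici 0) (f := fun x => ‖x‖ ^ 2)
      (fun s hs => (hφd s hs).continuousAt.continuousWithinAt) (by fun_prop)
      fun x => sq_nonneg ‖x‖
  have hφxc' : Continuous fun x : EuclideanSpace ℝ (Fin n) => φ' (‖x‖ ^ 2) :=
    hφc'.comp_continuous (f := fun x => ‖x‖ ^ 2) (by fun_prop) fun x => sq_nonneg ‖x‖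
  have hwt := continuous_weight (n := n) (-((n : ℝ) / 2))
  have hrd := continuous_radialDensity hu1
  have identity : ∀ x : EuclideanSpace ℝ (Fin n),
      φ (‖x‖ ^ 2) * ((n - 2) * energyDensity W u x + 2 * W (u x))
        - 2 * φ' (‖x‖ ^ 2) * (‖fderiv ℝ u x x‖ ^ 2 - ‖x‖ ^ 2 * energyDensity W u x) =
      ζ (‖x‖ ^ 2 / R ^ 2) ^ 2 * (((n : ℝ) - 2) *
        ((1 + ‖x‖ ^ 2) ^ (-((n : ℝ) / 2)) * energyDensity W u x + radialDensity u x)) +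
      2 * φ (‖x‖ ^ 2) * W (u x) - 4 * w (‖x‖ ^ 2) * ζ (‖x‖ ^ 2 / R ^ 2) / R ^ 2 *
        (ζ' (‖x‖ ^ 2 / R ^ 2) *
          (‖fderiv ℝ u x x‖ ^ 2 - ‖x‖ ^ 2 * energyDensity W u x)) := by
    intro x
    have e : w (‖x‖ ^ 2) = (1 + ‖x‖ ^ 2) * (1 + ‖x‖ ^ 2) ^ (-((n : ℝ) / 2)) := by
      have h1 : (0 : ℝ) < 1 + ‖x‖ ^ 2 := by positivity
      rw [mul_comm, ← Real.rpow_add_one h1.ne']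
      change (1 + ‖x‖ ^ 2) ^ (-α) = _
      congr 1
      rw [hα]
      ring
    have e' : w' (‖x‖ ^ 2) = -α * (1 + ‖x‖ ^ 2) ^ (-((n : ℝ) / 2)) := rfl
    simp only [hφ, hφ', radialDensity, e, e', hα]
    ring
  have hφnn : ∀ x : EuclideanSpace ℝ (Fin n), 0 ≤ 2 * φ (‖x‖ ^ 2) * W (u x) := fun x => by
    have := hW0 (u x)
    have : 0 ≤ w (‖x‖ ^ 2) := by positivity
    positivity
  have hgnn : ∀ x, 0 ≤ 16 * L / R ^ (n - 2) * energyDensity W u x := fun x =>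
    mul_nonneg (by positivity) (energyDensity_nonneg hW0 x)
  have hfnn : ∀ x : EuclideanSpace ℝ (Fin n), 0 ≤ ((n : ℝ) - 2) *
      ((1 + ‖x‖ ^ 2) ^ (-((n : ℝ) / 2)) * energyDensity W u x + radialDensity u x) := fun x =>
    mul_nonneg hn2 (add_nonneg (mul_nonneg (by positivity) (energyDensity_nonneg hW0 x))
      (radialDensity_nonneg x))
  have inner_bound : ∀ x : EuclideanSpace ℝ (Fin n), ‖x‖ ^ 2 ≤ R ^ 2 → ((n : ℝ) - 2) *
      ((1 + ‖x‖ ^ 2) ^ (-((n : ℝ) / 2)) * energyDensity W u x + radialDensity u x) ≤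
      φ (‖x‖ ^ 2) * ((n - 2) * energyDensity W u x + 2 * W (u x))
        - 2 * φ' (‖x‖ ^ 2) * (‖fderiv ℝ u x x‖ ^ 2 - ‖x‖ ^ 2 * energyDensity W u x) +
      16 * L / R ^ (n - 2) * energyDensity W u x := by
    intro x hx
    have : ‖x‖ ^ 2 / R ^ 2 ≤ 1 := by rwa [div_le_one (by positivity)]
    rw [identity x, hζ.eq_one _ this, hζ.deriv_of_le _ this]
    linarith [hφnn x, hgnn x]
  have key := setIntegral_ball_le_of_integral_eq_zero hR
    (f := fun x => ((n : ℝ) - 2) *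
      ((1 + ‖x‖ ^ 2) ^ (-((n : ℝ) / 2)) * energyDensity W u x + radialDensity u x))
    (I := fun x => φ (‖x‖ ^ 2) * ((n - 2) * energyDensity W u x + 2 * W (u x))
      - 2 * φ' (‖x‖ ^ 2) * (‖fderiv ℝ u x x‖ ^ 2 - ‖x‖ ^ 2 * energyDensity W u x))
    (g := fun x => 16 * L / R ^ (n - 2) * energyDensity W u x)
    (by fun_prop) ((hφxc.mul (by fun_prop)).sub ((continuous_const.mul hφxc').mul (by fun_prop)))
    ((hec.integrableOn_euclidean_ball _).const_mul _) hpoh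
    (fun x hx => by simp only [hφ0 _ hx, hφ0' _ hx]; ring)
    inner_bound
    (fun x hx => by
      rcases le_or_gt (‖x‖ ^ 2) (R ^ 2) with hxR | hxR
      · exact (hfnn x).trans (inner_bound x hxR)
      rw [identity x]
      have he := energyDensity_nonneg (u := u) hW0 x
      have hse : 0 ≤ ‖x‖ ^ 2 * energyDensity W u x := mul_nonneg (sq_nonneg _) he
      have hse4 : ‖x‖ ^ 2 * energyDensity W u x ≤ (2 * R) ^ 2 * energyDensity W u x :=
        mul_le_mul_of_nonneg_right hx he
      have hN := norm_fderiv_apply_self_sq_le_energyDensity (u := u) hW0 x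
      have hz0 := hζ.nonneg (‖x‖ ^ 2 / R ^ 2)
      have hz1 := hζ.le_one (‖x‖ ^ 2 / R ^ 2)
      have hz' := hζ.abs_deriv_le (‖x‖ ^ 2 / R ^ 2)
      have hf := mul_nonneg (sq_nonneg (ζ (‖x‖ ^ 2 / R ^ 2))) (hfnn x)
      set z := ζ (‖x‖ ^ 2 / R ^ 2)
      set z' := ζ' (‖x‖ ^ 2 / R ^ 2)
      have hwle : w (‖x‖ ^ 2) ≤ (R ^ (n - 2))⁻¹ := by
        rw [← hpow]
        exact Real.rpow_le_rpow_of_nonpos (by positivity) (by linarith) (by linarith)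
      have hw0 : 0 ≤ w (‖x‖ ^ 2) := by positivity
      have h1 : z' * (‖fderiv ℝ u x x‖ ^ 2 - ‖x‖ ^ 2 * energyDensity W u x) ≤
          L * ((2 * R) ^ 2 * energyDensity W u x) := by
        refine (le_abs_self _).trans ?_
        rw [abs_mul]
        refine mul_le_mul hz' ?_ (abs_nonneg _) hL
        rw [abs_le]
        constructor <;> linarith [sq_nonneg ‖fderiv ℝ u x x‖]
      have hwz : w (‖x‖ ^ 2) * z ≤ (R ^ (n - 2))⁻¹ :=
        (mul_le_of_le_one_right hw0 hz1).trans hwle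
      -- The constant `16` is the factor `4` in the identity times `(2R)²/R²`.
      have h2 : 4 * w (‖x‖ ^ 2) * z / R ^ 2 *
          (z' * (‖fderiv ℝ u x x‖ ^ 2 - ‖x‖ ^ 2 * energyDensity W u x)) ≤
          16 * L / R ^ (n - 2) * energyDensity W u x := by
        calc _ ≤ 4 * w (‖x‖ ^ 2) * z / R ^ 2 * (L * ((2 * R) ^ 2 * energyDensity W u x)) :=
              mul_le_mul_of_nonneg_left h1 (by positivity)
          _ = 16 * L * energyDensity W u x * (w (‖x‖ ^ 2) * z) := by
              field_simp
              ring
          _ ≤ 16 * L * energyDensity W u x * (R ^ (n - 2))⁻¹ :=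
              mul_le_mul_of_nonneg_left hwz (by positivity)
          _ = _ := by ring
      linarith [hφnn x, h2, hf])
  rwa [integral_const_mul (16 * L / R ^ (n - 2))] at key

end Pohozaev

/-! ### Growth of the energy and the Liouville theorem -/

section Asymptotics

variable {n : ℕ} {F : Type*} [NormedAddCommGroup F] [InnerProductSpace ℝ F]
  {u : EuclideanSpace ℝ (Fin n) → F} {M : ℝ} {Q : F} {W k : F → ℝ}

theorem isBigO_two_mul_pow (d : ℕ) :
    (fun R : ℝ => (2 * R) ^ d) =O[atTop] fun R : ℝ => R ^ d := by
  simp_rw [mul_pow]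
  exact (isBigO_refl _ _).const_mul_left _

theorem tendsto_two_mul_atTop : Tendsto (fun R : ℝ => 2 * R) atTop atTop :=
  tendsto_id.const_mul_atTop zero_lt_two

theorem Asymptotics.IsLittleO.comp_two_mul {f : ℝ → ℝ} {d : ℕ}
    (hf : f =o[atTop] fun R : ℝ => R ^ d) :
    (fun R => f (2 * R)) =o[atTop] fun R : ℝ => R ^ d :=
  (hf.comp_tendsto tendsto_two_mul_atTop).trans_isBigO (isBigO_two_mul_pow d)

theorem Asymptotics.IsBigO.comp_two_mul {f : ℝ → ℝ} {d : ℕ}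
    (hf : f =O[atTop] fun R : ℝ => R ^ d) :
    (fun R => f (2 * R)) =O[atTop] fun R : ℝ => R ^ d :=
  (hf.comp_tendsto tendsto_two_mul_atTop).trans (isBigO_two_mul_pow d)

theorem setIntegral_ball_energyDensity (hu : ContDiff ℝ 1 u) (hW : Continuous W) (R : ℝ) :
    ∫ x in Metric.ball 0 R, energyDensity W u x =
      (∫ x in Metric.ball 0 R, gradSq u x) / 2 + ∫ x in Metric.ball 0 R, W (u x) := by
  have hWu : Continuous fun x => W (u x) := hW.comp hu.continuous
  simp only [energyDensity]
  rw [integral_add (((continuous_gradSq hu).integrableOn_euclidean_ball R).div_const 2)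
    (hWu.integrableOn_euclidean_ball R), integral_div]

/-- The Dirichlet energy of a bounded solution grows at most like `R ^ (n - 2)`. -/
theorem isBigO_setIntegral_gradSq (hn : 2 ≤ n) (hu : ContDiff ℝ 2 u)
    (hkc : Continuous k) (hk0 : ∀ v, 0 ≤ k v) (hk : ∀ x, -⟪u x - Q, Δ u x⟫_ℝ ≤ k (u x))
    (hM : ∀ x, ‖u x - Q‖ ≤ M)
    (hko : (fun R : ℝ => ∫ x in Metric.ball 0 R, k (u x)) =o[atTop] fun R : ℝ => R ^ (n - 2)) :
    (fun R : ℝ => ∫ x in Metric.ball 0 R, gradSq u x) =O[atTop] fun R : ℝ => R ^ (n - 2) := by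
  obtain ⟨ζ, ζ', L, hζ⟩ := exists_isCutoff
  set ω := (volume : Measure (EuclideanSpace ℝ (Fin n))).real (Metric.ball 0 1) with hω
  have h1 : (fun R : ℝ => (∫ x in Metric.ball 0 (2 * R), k (u x)) +
      16 * (M * L) ^ 2 * 2 ^ n * ω * R ^ (n - 2)) =O[atTop] fun R : ℝ => R ^ (n - 2) :=
    hko.comp_two_mul.isBigO.add ((isBigO_refl _ _).const_mul_left _)
  refine IsBigO.trans (IsBigO.of_bound 1 ?_) h1
  filter_upwards [eventually_gt_atTop 0] with R hR
  rw [one_mul, Real.norm_of_nonneg (setIntegral_ball_nonneg (gradSq_nonneg u) R)]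
  refine ((setIntegral_gradSq_le hu hζ hR hkc hk0 hk hM).trans (le_of_eq ?_)).trans
    (Real.le_norm_self _)
  rw [measureReal_ball_eq _ (by positivity), mul_pow 2 R n, ← hω]
  have : R ^ n = R ^ (n - 2) * R ^ 2 := by rw [← pow_add, Nat.sub_add_cancel hn]
  rw [this]
  field_simp

/-- A bounded monotone function converges, so its values at `R` and `2R` share a limit. Applied to
the radial energy, this makes the annulus contribution vanish. -/
theorem tendsto_sub_comp_two_mul {H : ℝ → ℝ} (hH : Monotone H) {C : ℝ}
    (hC : ∀ᶠ R in atTop, H R ≤ C) : Tendsto (fun R => H (2 * R) - H R) atTop (𝓝 0) := by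
  have hb : BddAbove (Set.range H) := by
    refine ⟨C, ?_⟩
    rintro _ ⟨R, rfl⟩
    obtain ⟨R', h, hR'⟩ := (hC.and (eventually_ge_atTop R)).exists
    exact (hH hR').trans h
  have := tendsto_atTop_ciSup hH hb
  simpa using (this.comp tendsto_two_mul_atTop).sub this

/-- The Dirichlet energy of a bounded solution is `o(R ^ (n - 2))` as soon as the weighted radial
energy is finite. -/
theorem isLittleO_setIntegral_gradSq (hn : 2 ≤ n) (hu : ContDiff ℝ 2 u)
    (hkc : Continuous k) (hk0 : ∀ v, 0 ≤ k v) (hk : ∀ x, -⟪u x - Q, Δ u x⟫_ℝ ≤ k (u x))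
    (hM : ∀ x, ‖u x - Q‖ ≤ M)
    (hko : (fun R : ℝ => ∫ x in Metric.ball 0 R, k (u x)) =o[atTop] fun R : ℝ => R ^ (n - 2))
    {C : ℝ} (hC : ∀ᶠ R in atTop, ∫ x in Metric.ball 0 R, radialDensity u x ≤ C) :
    (fun R : ℝ => ∫ x in Metric.ball 0 R, gradSq u x) =o[atTop] fun R : ℝ => R ^ (n - 2) := by
  obtain ⟨ζ, ζ', L, hζ⟩ := exists_isCutoff
  have hL := hζ.bound_nonneg
  have hM0 : 0 ≤ M := (norm_nonneg _).trans (hM 0)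
  set ω := (volume : Measure (EuclideanSpace ℝ (Fin n))).real (Metric.ball 0 1) with hω
  have hω0 : 0 ≤ ω := measureReal_nonneg
  have htail := tendsto_sub_comp_two_mul (monotone_setIntegral_ball
    (continuous_radialDensity (hu.of_le one_le_two)) radialDensity_nonneg) hC
  rw [isLittleO_iff]
  intro δ hδ
  set A : ℝ := 4 * M * L * (2 ^ n * ω) with hA
  have hA0 : 0 ≤ A := by positivity
  -- The error `δ` is shared equally by the volume term, the annulus term and `∫ k(u)`. The `+ 1`
  -- covers `A = 0`.
  set ε : ℝ := δ / 3 / (A + 1) with hε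
  have hε0 : 0 < ε := by positivity
  have hAε : A * ε ≤ δ / 3 := by
    rw [hε, mul_div_assoc', div_le_iff₀ (by positivity)]
    nlinarith
  have htail' := htail.const_mul (4 * M * L * ((5 : ℝ) ^ ((n : ℝ) / 2) / ε))
  rw [mul_zero] at htail'
  filter_upwards [eventually_ge_atTop 1, htail'.eventually_le_const (show 0 < δ / 3 by positivity),
    (isLittleO_iff.1 hko.comp_two_mul) (show 0 < δ / 3 by positivity)] with R hR hT hK
  have hR0 : 0 < R := by linarith
  have hRp : 0 < R ^ (n - 2) := by positivity
  rw [Real.norm_of_nonneg hRp.le] at hK ⊢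
  rw [Real.norm_of_nonneg (setIntegral_ball_nonneg (gradSq_nonneg u) R)]
  have key := setIntegral_gradSq_le_radial hu hζ hR hkc hk0 hk hM0 hM hε0
  have hsplit : R ^ n = R ^ (n - 2) * R ^ 2 := by rw [← pow_add, Nat.sub_add_cancel hn]
  rw [measureReal_ball_eq _ (by positivity), mul_pow, hsplit, ← hω] at key
  set T := (∫ x in Metric.ball 0 (2 * R), radialDensity u x) -
    ∫ x in Metric.ball 0 R, radialDensity u x
  have e : 4 * M * L / R ^ 2 * (ε * (2 ^ n * (R ^ (n - 2) * R ^ 2) * ω) +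
      (5 : ℝ) ^ ((n : ℝ) / 2) * (R ^ (n - 2) * R ^ 2) / ε * T) =
      (A * ε + 4 * M * L * ((5 : ℝ) ^ ((n : ℝ) / 2) / ε) * T) * R ^ (n - 2) := by
    rw [hA]
    field_simp
  rw [e] at key
  have h3 : (A * ε + 4 * M * L * ((5 : ℝ) ^ ((n : ℝ) / 2) / ε) * T) * R ^ (n - 2) ≤
      (δ / 3 + δ / 3) * R ^ (n - 2) := mul_le_mul_of_nonneg_right (add_le_add hAε hT) hRp.le
  have h4 := (Real.le_norm_self _).trans hK
  linarith

theorem eq_zero_of_forall_setIntegral_ball_nonpos {f : EuclideanSpace ℝ (Fin n) → ℝ}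
    (hf : Continuous f) (hf0 : ∀ x, 0 ≤ f x) (h : ∀ R, ∫ x in Metric.ball 0 R, f x ≤ 0)
    (x : EuclideanSpace ℝ (Fin n)) : f x = 0 := by
  have h0 : ∫ x in Metric.ball 0 (‖x‖ + 1), f x = 0 :=
    le_antisymm (h _) (setIntegral_ball_nonneg hf0 _)
  rw [setIntegral_eq_zero_iff_of_nonneg_ae (ae_of_all _ hf0)
    (hf.integrableOn_euclidean_ball _)] at h0
  exact Measure.eqOn_open_of_ae_eq h0 Metric.isOpen_ball hf.continuousOn continuousOn_const
    (by simp)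

/-- A Liouville theorem: a bounded solution of `Δ u = ∇ W(u)` such that both `W(u)` and an upper
bound for `-(u - Q) · ∇ W(u)` have integral `o(R ^ (n - 2))` on balls of radius `R` is constant. -/
theorem exists_eq_const_of_isLittleO [CompleteSpace F] (hn : 3 ≤ n) (hu : ContDiff ℝ 2 u)
    (hW : ContDiff ℝ 1 W) (hW0 : ∀ v, 0 ≤ W v) (hu_eq : ∀ x, Δ u x = ∇ W (u x))
    (hkc : Continuous k) (hk0 : ∀ v, 0 ≤ k v) (hk : ∀ v, -⟪v - Q, ∇ W v⟫_ℝ ≤ k v)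
    (hM : ∀ x, ‖u x - Q‖ ≤ M)
    (hWo : (fun R : ℝ => ∫ x in Metric.ball 0 R, W (u x)) =o[atTop] fun R : ℝ => R ^ (n - 2))
    (hko : (fun R : ℝ => ∫ x in Metric.ball 0 R, k (u x)) =o[atTop] fun R : ℝ => R ^ (n - 2)) :
    ∃ c, ∀ x, u x = c := by
  have hn2 : 2 ≤ n := by omega
  have hnpos : (0 : ℝ) < n - 2 := by
    have : (3 : ℝ) ≤ n := by exact_mod_cast hn
    linarith
  have hu1 : ContDiff ℝ 1 u := hu.of_le one_le_two
  have hk' : ∀ x, -⟪u x - Q, Δ u x⟫_ℝ ≤ k (u x) := fun x => by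
    rw [hu_eq]
    exact hk _
  obtain ⟨ζ, ζ', L, hζ⟩ := exists_isCutoff
  have hL := hζ.bound_nonneg
  have hec := continuous_energyDensity hu1 hW.continuous
  have he0 := energyDensity_nonneg (u := u) hW0
  have hrc := continuous_radialDensity hu1
  have hwc := continuous_weight (n := n) (-((n : ℝ) / 2))
  have hE : (fun R : ℝ => ∫ x in Metric.ball 0 R, energyDensity W u x) = fun R : ℝ =>
      2⁻¹ * (∫ x in Metric.ball 0 R, gradSq u x) + ∫ x in Metric.ball 0 R, W (u x) := by
    ext R
    rw [setIntegral_ball_energyDensity hu1 hW.continuous]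
    ring
  have hEO : (fun R : ℝ => ∫ x in Metric.ball 0 R, energyDensity W u x) =O[atTop]
      fun R : ℝ => R ^ (n - 2) := by
    rw [hE]
    exact ((isBigO_setIntegral_gradSq hn2 hu hkc hk0 hk' hM hko).const_mul_left _).add hWo.isBigO
  have hmain := fun R (hR : 0 < R) => setIntegral_weighted_energy_le hn2 hu hW hW0 hu_eq hζ hR
  have hw0 : ∀ x : EuclideanSpace ℝ (Fin n),
      0 ≤ (1 + ‖x‖ ^ 2) ^ (-((n : ℝ) / 2)) * energyDensity W u x := fun x =>
    mul_nonneg (by positivity) (he0 x)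
  obtain ⟨C, hC⟩ := hEO.comp_two_mul.bound
  -- First use of the monotonicity inequality: energy `O(R^(n-2))` makes the radial energy bounded.
  have hbdd : ∀ᶠ R in atTop, ∫ x in Metric.ball 0 R, radialDensity u x ≤
      16 * L * C / (n - 2) := by
    filter_upwards [eventually_gt_atTop 0, hC] with R hR hCR
    have hRp : 0 < R ^ (n - 2) := by positivity
    rw [Real.norm_of_nonneg hRp.le] at hCR
    rw [le_div_iff₀ hnpos, mul_comm, ← integral_const_mul]
    calc _ ≤ ∫ x in Metric.ball 0 R, ((n : ℝ) - 2) *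
          ((1 + ‖x‖ ^ 2) ^ (-((n : ℝ) / 2)) * energyDensity W u x + radialDensity u x) := by
          refine setIntegral_mono
            (Continuous.integrableOn_euclidean_ball (by fun_prop) R)
            (Continuous.integrableOn_euclidean_ball (by fun_prop) R) fun x => ?_
          exact mul_le_mul_of_nonneg_left (by linarith [hw0 x]) hnpos.le
      _ ≤ _ := hmain R hR
      _ ≤ 16 * L / R ^ (n - 2) * (C * R ^ (n - 2)) :=
          mul_le_mul_of_nonneg_left ((Real.le_norm_self _).trans hCR) (by positivity)
      _ = 16 * L * C := by field_simp
  have hEo : (fun R : ℝ => ∫ x in Metric.ball 0 R, energyDensity W u x) =o[atTop]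
      fun R : ℝ => R ^ (n - 2) := by
    rw [hE]
    exact ((isLittleO_setIntegral_gradSq hn2 hu hkc hk0 hk' hM hko hbdd).const_mul_left _).add hWo
  have hlim := (hEo.comp_two_mul.tendsto_div_nhds_zero).const_mul (16 * L)
  rw [mul_zero] at hlim
  -- Second use, now with energy `o(R^(n-2))`: the ball of radius `K` stays fixed while `R → ∞`.
  have hzero := eq_zero_of_forall_setIntegral_ball_nonpos
    (f := fun x => ((n : ℝ) - 2) *
      ((1 + ‖x‖ ^ 2) ^ (-((n : ℝ) / 2)) * energyDensity W u x + radialDensity u x))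
    (by fun_prop)
    (fun x => mul_nonneg hnpos.le (add_nonneg (hw0 x) (radialDensity_nonneg x)))
    (fun K => by
      refine ge_of_tendsto hlim ?_
      filter_upwards [eventually_gt_atTop 0, eventually_ge_atTop K] with R hR hKR
      refine (monotone_setIntegral_ball (by fun_prop)
        (fun x => mul_nonneg hnpos.le (add_nonneg (hw0 x) (radialDensity_nonneg x))) hKR).trans ?_
      refine (hmain R hR).trans (le_of_eq ?_)
      ring)
  have hgrad : ∀ x, gradSq u x = 0 := fun x => by
    have h1 : (1 + ‖x‖ ^ 2) ^ (-((n : ℝ) / 2)) * energyDensity W u x + radialDensity u x = 0 :=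
      (mul_eq_zero.1 (hzero x)).resolve_left hnpos.ne'
    have h2 : (1 + ‖x‖ ^ 2) ^ (-((n : ℝ) / 2)) * energyDensity W u x = 0 := by
      linarith [hw0 x, radialDensity_nonneg (u := u) x]
    have h3 : energyDensity W u x = 0 := (mul_eq_zero.1 h2).resolve_left (by positivity)
    have h4 := gradSq_nonneg u x
    have h5 := hW0 (u x)
    simp only [energyDensity] at h3
    linarith
  refine ⟨u 0, fun x => is_const_of_fderiv_eq_zero (𝕜 := ℝ) (hu.differentiable two_ne_zero)
    (fun y => ?_) x 0⟩
  ext v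
  have := norm_fderiv_apply_sq_le u y v
  rw [hgrad y, mul_zero] at this
  simpa using pow_eq_zero_iff two_ne_zero |>.1 (le_antisymm this (sq_nonneg _))

end Asymptotics

/-! ### Growth of the integral of `W(u)^((p-1)/p)` -/

section PotentialGrowth

/-- Rescaling of `s^θ ≤ s + 1`, valid for `0 ≤ θ ≤ 1`, with `s = a^(p/(p-1)) t`, followed by
division by `a`. -/
theorem rpow_le_mul_add_inv {p t a : ℝ} (hp : 1 < p) (ht : 0 ≤ t) (ha : 0 < a) :
    t ^ ((p - 1) / p) ≤ a ^ (1 / (p - 1)) * t + a⁻¹ := by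
  have hp0 : 0 < p - 1 := by linarith
  have hp1 : 0 < p := by linarith
  have hθ0 : 0 ≤ (p - 1) / p := by positivity
  have hθ1 : (p - 1) / p ≤ 1 := by
    rw [div_le_one hp1]
    linarith
  have hb : 0 < a ^ (p / (p - 1)) := Real.rpow_pos_of_pos ha _
  set s := a ^ (p / (p - 1)) * t with hs
  have hs0 : 0 ≤ s := by positivity
  have h1 : s ^ ((p - 1) / p) = a * t ^ ((p - 1) / p) := by
    rw [hs, Real.mul_rpow hb.le ht, ← Real.rpow_mul ha.le]
    have : p / (p - 1) * ((p - 1) / p) = 1 := by field_simp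
    rw [this, Real.rpow_one]
  have h2 : s ^ ((p - 1) / p) ≤ s + 1 := by
    rcases le_total s 1 with h | h
    · linarith [Real.rpow_le_one hs0 h hθ0]
    · have := Real.rpow_le_rpow_of_exponent_le h hθ1
      rw [Real.rpow_one] at this
      linarith
  have h3 : s = a * (a ^ (1 / (p - 1)) * t) := by
    have : p / (p - 1) = 1 + 1 / (p - 1) := by
      field_simp
      ring
    rw [hs, this, Real.rpow_add ha, Real.rpow_one]
    ring
  rw [h1, h3] at h2
  have h4 : a * t ^ ((p - 1) / p) ≤ a * (a ^ (1 / (p - 1)) * t + a⁻¹) := by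
    rw [mul_add, mul_inv_cancel₀ ha.ne']
    exact h2
  exact le_of_mul_le_mul_left h4 ha

variable {n : ℕ} {f : EuclideanSpace ℝ (Fin n) → ℝ} {p : ℝ}

theorem setIntegral_rpow_le (hp : 1 < p) (hf : Continuous f) (hf0 : ∀ x, 0 ≤ f x) {a K R : ℝ}
    (ha : 0 < a) (hR : 0 < R) (hKR : K ≤ R) :
    ∫ x in Metric.ball 0 R, f x ^ ((p - 1) / p) ≤
      (∫ x in Metric.ball 0 K, f x ^ ((p - 1) / p)) +
      a ^ (1 / (p - 1)) * ((∫ x in Metric.ball 0 R, f x) - ∫ x in Metric.ball 0 K, f x) +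
      a⁻¹ * (R ^ n * (volume : Measure (EuclideanSpace ℝ (Fin n))).real (Metric.ball 0 1)) := by
  have hθ0 : 0 ≤ (p - 1) / p := div_nonneg (by linarith) (by linarith)
  have hfp : Continuous fun x => f x ^ ((p - 1) / p) :=
    hf.rpow_const fun x => Or.inr hθ0
  -- The gap in the pointwise inequality is nonnegative, so its ball integrals increase with the
  -- radius. Comparing `K` with `R` applies the inequality only on `B_R \ B_K`.
  have hmono := monotone_setIntegral_ball
    (f := fun x => a ^ (1 / (p - 1)) * f x + a⁻¹ - f x ^ ((p - 1) / p)) (by fun_prop)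
    (fun x => sub_nonneg.2 (rpow_le_mul_add_inv hp (hf0 x) ha)) hKR
  have hsplit : ∀ r : ℝ, ∫ x in Metric.ball (0 : EuclideanSpace ℝ (Fin n)) r,
      (a ^ (1 / (p - 1)) * f x + a⁻¹ - f x ^ ((p - 1) / p)) =
      a ^ (1 / (p - 1)) * (∫ x in Metric.ball 0 r, f x) +
        a⁻¹ * (volume : Measure (EuclideanSpace ℝ (Fin n))).real (Metric.ball 0 r) -
        ∫ x in Metric.ball 0 r, f x ^ ((p - 1) / p) := fun r => by
    have h1 := (hf.integrableOn_euclidean_ball r).const_mul (a ^ (1 / (p - 1)))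
    have h2 : IntegrableOn (fun _ : EuclideanSpace ℝ (Fin n) => a⁻¹) (Metric.ball 0 r) :=
      continuous_const.integrableOn_euclidean_ball r
    have h3 : IntegrableOn (fun x => a ^ (1 / (p - 1)) * f x + a⁻¹) (Metric.ball 0 r) :=
      h1.add h2
    rw [integral_sub h3 (hfp.integrableOn_euclidean_ball r), integral_add h1 h2,
      integral_const_mul, setIntegral_const, smul_eq_mul]
    ring
  simp only [hsplit] at hmono
  rw [measureReal_ball_eq R hR] at hmono
  have : 0 ≤ a⁻¹ * (volume : Measure (EuclideanSpace ℝ (Fin n))).real (Metric.ball 0 K) :=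
    mul_nonneg (inv_nonneg.2 ha.le) measureReal_nonneg
  linarith

theorem isLittleO_setIntegral_rpow (hn : 2 ≤ n) (hp : 1 < p) (hf : Continuous f)
    (hf0 : ∀ x, 0 ≤ f x)
    (h : (fun R : ℝ => ∫ x in Metric.ball 0 R, f x) =o[atTop]
      fun R : ℝ => R ^ ((n : ℝ) - 2 - 2 / (p - 1))) :
    (fun R : ℝ => ∫ x in Metric.ball 0 R, f x ^ ((p - 1) / p)) =o[atTop]
      fun R : ℝ => R ^ (n - 2) := by
  set ω := (volume : Measure (EuclideanSpace ℝ (Fin n))).real (Metric.ball 0 1) with hω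
  have hω0 : 0 ≤ ω := measureReal_nonneg
  rw [isLittleO_iff] at h ⊢
  intro δ hδ
  set τ : ℝ := 2 * (ω + 1) / δ with hτ
  have hτ0 : 0 < τ := by positivity
  have hωτ : τ⁻¹ * ω ≤ δ / 2 := by
    rw [inv_mul_le_iff₀ hτ0, hτ]
    field_simp
    linarith
  have hτp : 0 < τ ^ (1 / (p - 1)) := Real.rpow_pos_of_pos hτ0 _
  filter_upwards [eventually_gt_atTop 0,
    h (show 0 < δ / 2 / τ ^ (1 / (p - 1)) by positivity)] with R hR hI
  rw [Real.norm_of_nonneg (setIntegral_ball_nonneg hf0 R),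
    Real.norm_of_nonneg (by positivity)] at hI
  rw [Real.norm_of_nonneg (setIntegral_ball_nonneg (fun x => Real.rpow_nonneg (hf0 x) _) R),
    Real.norm_of_nonneg (by positivity)]
  -- Here `K = 0`, so the inner ball is empty. With `a = τ R²` the volume term is `τ⁻¹ ω R^(n-2)`,
  -- and the other carries `R^(2/(p-1))`, which restores the exponent `n - 2`.
  have key := setIntegral_rpow_le hp hf hf0 (show 0 < τ * R ^ 2 by positivity) hR hR.le
  rw [Metric.ball_zero] at key
  simp only [Measure.restrict_empty, integral_zero_measure, zero_add, sub_zero] at key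
  have h1 : (τ * R ^ 2) ^ (1 / (p - 1)) * ∫ x in Metric.ball 0 R, f x ≤
      δ / 2 * R ^ (n - 2) := by
    have hpos : 0 ≤ (τ * R ^ 2) ^ (1 / (p - 1)) := by positivity
    refine (mul_le_mul_of_nonneg_left hI hpos).trans (le_of_eq ?_)
    have e : R ^ (n - 2) = R ^ (2 / (p - 1)) * R ^ ((n : ℝ) - 2 - 2 / (p - 1)) := by
      rw [← Real.rpow_add hR, ← Real.rpow_natCast, Nat.cast_sub hn]
      congr 1
      push_cast
      ring
    have e2 : (R ^ 2) ^ (1 / (p - 1)) = R ^ (2 / (p - 1)) := by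
      rw [← Real.rpow_natCast_mul hR.le]
      congr 1
      push_cast
      ring
    rw [Real.mul_rpow hτ0.le (by positivity), e2, e]
    field_simp
  have h2 : (τ * R ^ 2)⁻¹ * (R ^ n * ω) ≤ δ / 2 * R ^ (n - 2) := by
    have e : (τ * R ^ 2)⁻¹ * (R ^ n * ω) = τ⁻¹ * ω * R ^ (n - 2) := by
      have : R ^ n = R ^ (n - 2) * R ^ 2 := by rw [← pow_add, Nat.sub_add_cancel hn]
      rw [this]
      field_simp
    rw [e]
    exact mul_le_mul_of_nonneg_right hωτ (by positivity)
  linarith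

/-- The choice `a = τ R²` multiplies the integral of `f` by `R²`, so that integral must be small
rather than merely finite. Removing a large fixed ball `B_K` leaves a small tail, and the removed
part is a constant, negligible against `R²`. -/
theorem isLittleO_setIntegral_rpow_half {f : EuclideanSpace ℝ (Fin 4) → ℝ} (hf : Continuous f)
    (hf0 : ∀ x, 0 ≤ f x) (hfi : Integrable f) :
    (fun R : ℝ => ∫ x in Metric.ball 0 R, f x ^ (((2 : ℝ) - 1) / 2)) =o[atTop]
      fun R : ℝ => R ^ 2 := by
  set ω := (volume : Measure (EuclideanSpace ℝ (Fin 4))).real (Metric.ball 0 1) with hω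
  have hω0 : 0 ≤ ω := measureReal_nonneg
  set I : ℝ → ℝ := fun R => ∫ x in Metric.ball 0 R, f x with hI
  have hb : BddAbove (Set.range I) := by
    refine ⟨∫ x, f x, ?_⟩
    rintro _ ⟨R, rfl⟩
    exact setIntegral_le_integral hfi (ae_of_all _ hf0)
  have hlim := tendsto_atTop_ciSup (monotone_setIntegral_ball hf hf0) hb
  rw [isLittleO_iff]
  intro δ hδ
  set τ : ℝ := 3 * (ω + 1) / δ with hτ
  have hτ0 : 0 < τ := by positivity
  have hωτ : τ⁻¹ * ω ≤ δ / 3 := by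
    rw [inv_mul_le_iff₀ hτ0, hτ]
    field_simp
    linarith
  obtain ⟨K, hK⟩ := (hlim.eventually_const_lt
    (show (⨆ R, I R) - δ / 3 / τ < ⨆ R, I R from sub_lt_self _ (by positivity))).exists
  have hsmall := (tendsto_pow_atTop (α := ℝ) two_ne_zero).eventually_ge_atTop
    ((∫ x in Metric.ball 0 K, f x ^ (((2 : ℝ) - 1) / 2)) / (δ / 3))
  filter_upwards [eventually_gt_atTop 0, eventually_ge_atTop K, hsmall] with R hR hKR hRs
  rw [Real.norm_of_nonneg (setIntegral_ball_nonneg (fun x => Real.rpow_nonneg (hf0 x) _) R),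
    Real.norm_of_nonneg (by positivity)]
  rw [div_le_iff₀ (by positivity)] at hRs
  have key := setIntegral_rpow_le (p := 2) one_lt_two hf hf0
    (show 0 < τ * R ^ 2 by positivity) hR hKR
  have hexp : (1 : ℝ) / (2 - 1) = 1 := by norm_num
  rw [hexp, Real.rpow_one] at key
  have h1 : I R - I K ≤ δ / 3 / τ := by
    have := le_ciSup hb R
    change _ < I K at hK
    linarith
  have h2 : τ * R ^ 2 * (I R - I K) ≤ δ / 3 * R ^ 2 := by
    refine (mul_le_mul_of_nonneg_left h1 (by positivity)).trans (le_of_eq ?_)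
    field_simp
  have h3 : (τ * R ^ 2)⁻¹ * (R ^ 4 * ω) ≤ δ / 3 * R ^ 2 := by
    have e : (τ * R ^ 2)⁻¹ * (R ^ 4 * ω) = τ⁻¹ * ω * R ^ 2 := by field_simp
    rw [e]
    exact mul_le_mul_of_nonneg_right hωτ (by positivity)
  linarith

end PotentialGrowth

/-! ### The main theorem -/

theorem theorem1 {n m : ℕ}
    (W : EuclideanSpace ℝ (Fin m) → ℝ)
    (hW : ContDiff ℝ 1 W)
    (hW_nonneg : ∀ v, 0 ≤ W v)
    (Q : EuclideanSpace ℝ (Fin m)) (p C₂ : ℝ)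
    (hp : 2 ≤ p) (hC₂ : 0 < C₂)
    (hWQ : ∀ v, -⟪v - Q, ∇ W v⟫_ℝ ≤ C₂ * W v ^ ((p - 1) / p))
    (u : EuclideanSpace ℝ (Fin n) → EuclideanSpace ℝ (Fin m))
    (hu : ContDiff ℝ 2 u)
    (hu_bdd : ∃ M : ℝ, ∀ x, ‖u x‖ ≤ M)
    (hu_eq : ∀ x, Δ u x = ∇ W (u x)) :
    -- Part I, with the two expressions for the exponent
    (4 ≤ n →
      p / (p - 1) * ((n : ℝ) - 2 - n / p) = (n : ℝ) - 2 - 2 / (p - 1) ∧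
      ((fun r : ℝ => ∫ x in Metric.ball (0 : EuclideanSpace ℝ (Fin n)) r, W (u x))
          =o[atTop] (fun r : ℝ => r ^ ((n : ℝ) - 2 - 2 / (p - 1))) →
        ∃ c, ∀ x, u x = c)) ∧
    -- Part II
    (n = 4 → p = 2 →
      (∫⁻ x, ENNReal.ofReal (W (u x))) < ⊤ →
        ∃ c, ∀ x, u x = c) := by
  obtain ⟨M, hM⟩ := hu_bdd
  have hM' : ∀ x, ‖u x - Q‖ ≤ M + ‖Q‖ := fun x =>
    (norm_sub_le _ _).trans (by linarith [hM x])
  have hp0 : 0 < p := by linarith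
  have hp1 : 0 < p - 1 := by linarith
  have hkc : Continuous fun v => C₂ * W v ^ ((p - 1) / p) :=
    continuous_const.mul (hW.continuous.rpow_const fun v => Or.inr (by positivity))
  have hk0 : ∀ v, 0 ≤ C₂ * W v ^ ((p - 1) / p) := fun v =>
    mul_nonneg hC₂.le (Real.rpow_nonneg (hW_nonneg v) _)
  have hWu : Continuous fun x => W (u x) := hW.continuous.comp hu.continuous
  refine ⟨fun hn => ⟨?_, fun h => ?_⟩, fun hn hp2 hfin => ?_⟩
  · field_simp
    ring
  · refine exists_eq_const_of_isLittleO (by omega) hu hW hW_nonneg hu_eq hkc hk0 hWQ hM' ?_ ?_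
    -- The bound on `W` itself is the weaker requirement, since `q ≤ n - 2`.
    · refine h.trans_isBigO (IsBigO.of_bound 1 ?_)
      filter_upwards [eventually_ge_atTop 1] with R hR
      have hR0 : 0 < R := by linarith
      rw [one_mul, Real.norm_of_nonneg (by positivity), Real.norm_of_nonneg (by positivity),
        ← Real.rpow_natCast, Nat.cast_sub (by omega)]
      refine Real.rpow_le_rpow_of_exponent_le hR ?_
      have : 0 < 2 / (p - 1) := by positivity
      push_cast
      linarith
    · simp only [integral_const_mul]
      exact (isLittleO_setIntegral_rpow (by omega) (by linarith) hWu (fun x => hW_nonneg _)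
        h).const_mul_left _
  · subst hn hp2
    have hint : Integrable fun x => W (u x) := by
      refine ⟨hWu.aestronglyMeasurable, ?_⟩
      rwa [hasFiniteIntegral_iff_ofReal (ae_of_all _ fun x => hW_nonneg _)]
    refine exists_eq_const_of_isLittleO (by omega) hu hW hW_nonneg hu_eq hkc hk0 hWQ hM' ?_ ?_
    · have h1 : (fun R : ℝ => ∫ x in Metric.ball (0 : EuclideanSpace ℝ (Fin 4)) R, W (u x))
          =O[atTop] fun _ : ℝ => (1 : ℝ) := by
        refine IsBigO.of_bound (∫ x, W (u x)) (Eventually.of_forall fun R => ?_)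
        rw [Real.norm_of_nonneg (setIntegral_ball_nonneg (fun x => hW_nonneg _) R), norm_one,
          mul_one]
        exact setIntegral_le_integral hint (ae_of_all _ fun x => hW_nonneg _)
      refine h1.trans_isLittleO ((isLittleO_one_left_iff ℝ).2 ?_)
      exact tendsto_norm_atTop_atTop.comp (tendsto_pow_atTop (by norm_num))
    · simp only [integral_const_mul]
      exact (isLittleO_setIntegral_rpow_half hWu (fun x => hW_nonneg _) hint).const_mul_left _
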